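/- All rings are unital and associative, not necessarily commutative. Let $B=\bigoplus_{n\ge 0}B_n$ be an $\mathbb{N}$-graded ring, with a ring homomorphism $S\to B$ that identifies $S$ with $B_0$; regard $S$ as a left and as a right graded $B$-module, concentrated in degree $0$, via the augmentation $B\to B_0\cong S$. Call $B$ *left finitely projective Koszul over $S$* if every $B_n$ is finitely generated projective as a left $S$-module, every $B_n$ is flat as a left $S$-module, and $\mathrm{Tor}^B_{i,j}(S,S)=0$ for all $i\neq j$, where $i$ is the homological degree and $j$ is the internal degree induced by the grading of $B$. Let $$\begin{array}{ccc} K & \to & C\\ \downarrow & & \downarrow\\ R & \to & A\end{array}$$ be a commutative square of ring homomorphisms such that the map $R\otimes_K C\to A$, $r\otimes c\mapsto rc$, formed with the product of $A$, is bijective. Suppose that $C=\bigoplus_{n\ge 0}C_n$ is an $\mathbb{N}$-graded ring such that $K\to C$ identifies $K$ with $C_0$, and put $F_nC=\bigoplus_{i\le n}C_i$. Let $F_nA\subseteq A$ be the image of $R\otimes_K F_nC$. Suppose that 1. $C$ is left finitely projective Koszul over $K$; 2. $(F_nA)_{n\ge 0}$ makes $A$ a filtered ring, that is, $F_mA\cdot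 F_nA\subseteq F_{m+n}A$ for all $m,n$; 3. $R$ is flat as a right $K$-module. Then $R\to A$ identifies $R$ with $F_0A=\mathrm{gr}^F_0A$, and $A$ is left finitely projective Koszul over $R$, i.e. the associated graded ring $\mathrm{gr}^FA=\bigoplus_{n\ge 0}F_nA/F_{n-1}A$ (with $F_{-1}A=0$) is left finitely projective Koszul over $R$. -/

import Mathlib

universe u

open scoped TensorProduct

noncomputable section

namespace RelKoszul

/-! ### Restriction of scalars along a ring homomorphism -/

section Restriction

variable {K S : Type u} [Ring K] [Ring S]

/-- The ring `S` regarded as a left `K`-module along `f : K →+* S`, that is `k • s = f k * s`. -/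
def LeftVia (_f : K →+* S) : Type u := S

/-- The ring `S` regarded as a right `K`-module along `f : K →+* S`, that is `s • k = s * f k`.
Right `K`-modules are modules over `Kᵐᵒᵖ`. -/
def RightVia (_f : K →+* S) : Type u := S

variable (f : K →+* S)

instance : AddCommGroup (LeftVia f) := inferInstanceAs (AddCommGroup S)

instance : Module K (LeftVia f) := Module.compHom S f

instance : AddCommGroup (RightVia f) := inferInstanceAs (AddCommGroup S)

instance : Module Kᵐᵒᵖ (RightVia f) := Module.compHom S f.op

theorem LeftVia.smul_def (k : K) (s : S) :
    (show S from k • (show LeftVia f from s)) = f k * s := rfl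

theorem RightVia.smul_def (k : K) (s : S) :
    (show S from MulOpposite.op k • (show RightVia f from s)) = s * f k := rfl

end Restriction

/-! ### Tensor products and flatness over a noncommutative ring -/

section Tensor

variable (K : Type u) [Ring K]

/-- The subgroup of `M ⊗[ℤ] N` generated by all `m k ⊗ n - m ⊗ k n`. -/
def balancedRel (M N : Type u) [AddCommGroup M] [Module Kᵐᵒᵖ M] [AddCommGroup N] [Module K N] :
    Submodule ℤ (M ⊗[ℤ] N) :=
  Submodule.span ℤ
    {x | ∃ (m : M) (k : K) (n : N), x = (MulOpposite.op k • m) ⊗ₜ[ℤ] n - m ⊗ₜ[ℤ] (k • n)}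

/-- The tensor product `M ⊗_K N` of a right `K`-module `M` and a left `K`-module `N`,
an abelian group. -/
abbrev BTensor (M N : Type u) [AddCommGroup M] [Module Kᵐᵒᵖ M] [AddCommGroup N] [Module K N] :
    Type u :=
  (M ⊗[ℤ] N) ⧸ balancedRel K M N

variable {M M' N N' : Type u}
  [AddCommGroup M] [Module Kᵐᵒᵖ M] [AddCommGroup M'] [Module Kᵐᵒᵖ M']
  [AddCommGroup N] [Module K N] [AddCommGroup N'] [Module K N']

/-- The pure tensor `m ⊗ n` in `M ⊗_K N`. -/
def btmul (m : M) (n : N) : BTensor K M N := (balancedRel K M N).mkQ (m ⊗ₜ[ℤ] n)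

/-- The map `g ⊗ f : M ⊗_K N → M' ⊗_K N'` induced by linear maps. -/
def btmap (g : M →ₗ[Kᵐᵒᵖ] M') (f : N →ₗ[K] N') : BTensor K M N →ₗ[ℤ] BTensor K M' N' :=
  Submodule.mapQ _ _
    (TensorProduct.map g.toAddMonoidHom.toIntLinearMap f.toAddMonoidHom.toIntLinearMap) <| by
      rw [balancedRel, Submodule.span_le]
      rintro _ ⟨m, k, n, rfl⟩
      refine Submodule.subset_span ⟨g m, k, f n, ?_⟩
      rw [← map_smul g, ← map_smul f]
      exact map_sub (TensorProduct.map g.toAddMonoidHom.toIntLinearMap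
        f.toAddMonoidHom.toIntLinearMap) _ _

@[simp]
theorem btmap_btmul (g : M →ₗ[Kᵐᵒᵖ] M') (f : N →ₗ[K] N') (m : M) (n : N) :
    btmap K g f (btmul K m n) = btmul K (g m) (f n) := rfl

/-- The right `K`-module `M` is flat: `M ⊗_K -` preserves injections of left `K`-modules. -/
def IsRightFlat (M : Type u) [AddCommGroup M] [Module Kᵐᵒᵖ M] : Prop :=
  ∀ (N N' : Type u) [AddCommGroup N] [Module K N] [AddCommGroup N'] [Module K N']
    (f : N →ₗ[K] N'), Function.Injective f →
      Function.Injective (btmap K (LinearMap.id : M →ₗ[Kᵐᵒᵖ] M) f)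

/-- The left `K`-module `N` is flat: `- ⊗_K N` preserves injections of right `K`-modules. -/
def IsLeftFlat (N : Type u) [AddCommGroup N] [Module K N] : Prop :=
  ∀ (M M' : Type u) [AddCommGroup M] [Module Kᵐᵒᵖ M] [AddCommGroup M'] [Module Kᵐᵒᵖ M']
    (g : M →ₗ[Kᵐᵒᵖ] M'), Function.Injective g →
      Function.Injective (btmap K g (LinearMap.id : N →ₗ[K] N))

end Tensor

/-! ### Graded modules and graded projective resolutions -/

section GradedModules

variable {B : Type u} [Ring B] (ℬ : ℕ → AddSubgroup B)

/-- The family `deg` makes the left `B`-module `M` an `ℕ`-graded module over the graded ring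
`B = ⨁ ℬ n`. -/
structure IsGradedModule {M : Type u} [AddCommGroup M] [Module B M] (deg : ℕ → AddSubgroup M) :
    Prop where
  isInternal : DirectSum.IsInternal deg
  smul_mem : ∀ {a c : ℕ} {b : B} {m : M}, b ∈ ℬ a → m ∈ deg c → b • m ∈ deg (a + c)

/-- An `ℕ`-graded left module over the graded ring `B = ⨁ ℬ n`. -/
structure GrMod where
  carrier : Type u
  [addCommGroup : AddCommGroup carrier]
  [module : Module B carrier]
  deg : ℕ → AddSubgroup carrier
  isGraded : IsGradedModule ℬ deg

attribute [instance] GrMod.addCommGroup GrMod.module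

variable {ℬ}

/-- A `B`-linear map is homogeneous of degree zero. -/
def IsHomogeneousMap {M N : GrMod ℬ} (f : M.carrier →ₗ[B] N.carrier) : Prop :=
  ∀ (n : ℕ) (m : M.carrier), m ∈ M.deg n → f m ∈ N.deg n

/-- A resolution `⋯ → X 1 → X 0 → N → 0` of the graded left module `N` by projective graded left
modules, with differentials and augmentation homogeneous of degree zero. -/
structure GradedProjRes (N : GrMod ℬ) where
  X : ℕ → GrMod ℬ
  projective : ∀ i, Module.Projective B (X i).carrier
  d : ∀ i, (X (i + 1)).carrier →ₗ[B] (X i).carrier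
  d_homogeneous : ∀ i, IsHomogeneousMap (d i)
  aug : (X 0).carrier →ₗ[B] N.carrier
  aug_homogeneous : IsHomogeneousMap aug
  aug_surjective : Function.Surjective aug
  exact_zero : Function.Exact (d 0) aug
  exact_succ : ∀ i, Function.Exact (d (i + 1)) (d i)

/-! Existence of graded projective resolutions. -/

/-- A criterion for gradings in terms of the projections on the components. -/
theorem isInternal_of_proj {M : Type u} [AddCommGroup M] (deg : ℕ → AddSubgroup M)
    (π : ℕ → M →+ M) (hmem : ∀ n x, π n x ∈ deg n)
    (hsame : ∀ n x, x ∈ deg n → π n x = x)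
    (hdiff : ∀ m n x, x ∈ deg m → m ≠ n → π n x = 0)
    (hsum : ∀ x, ∃ s : Finset ℕ, ∑ n ∈ s, π n x = x) : DirectSum.IsInternal deg := by
  constructor
  · rw [injective_iff_map_eq_zero]
    intro v hv
    have key : ∀ (v : DirectSum ℕ fun n => deg n) (n : ℕ),
        π n (DirectSum.coeAddMonoidHom deg v) = v n := by
      intro v n
      induction v using DirectSum.induction_on with
      | zero => simp
      | of m x =>
        rw [DirectSum.coeAddMonoidHom_of]
        by_cases h : m = n
        · subst h
          rw [hsame _ _ x.2, DirectSum.of_eq_same]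
        · rw [hdiff m n x x.2 h, DirectSum.of_eq_of_ne _ _ _ (Ne.symm h)]
          rfl
      | add x y hx hy => simp [hx, hy]
    ext n
    rw [← key, hv]
    simp
  · intro x
    obtain ⟨s, hs⟩ := hsum x
    refine ⟨∑ n ∈ s, DirectSum.of (fun n => deg n) n ⟨π n x, hmem n x⟩, ?_⟩
    rw [map_sum]
    simpa using hs

/-- Conversely, a grading has projections on its components. -/
theorem exists_proj {M : Type u} [AddCommGroup M] (deg : ℕ → AddSubgroup M)
    (h : DirectSum.IsInternal deg) :
    ∃ π : ℕ → M →+ M, (∀ n x, π n x ∈ deg n) ∧ (∀ n x, x ∈ deg n → π n x = x) ∧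
      (∀ m n x, x ∈ deg m → m ≠ n → π n x = 0) ∧ (∀ x, ∃ s : Finset ℕ, ∑ n ∈ s, π n x = x) ∧
      (∀ x, ∃ s : Finset ℕ, ∀ n, n ∉ s → π n x = 0) := by
  classical
  let := h.chooseDecomposition
  refine ⟨fun n => (deg n).subtype.comp
    ((DirectSum.component ℤ ℕ (fun n => deg n) n).toAddMonoidHom.comp
      (DirectSum.decomposeAddEquiv deg).toAddMonoidHom), ?_, ?_, ?_, ?_, ?_⟩
  · intro n x
    exact (DirectSum.decompose deg x n).2
  · intro n x hx
    exact DirectSum.decompose_of_mem_same deg hx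
  · intro m n x hx hmn
    exact DirectSum.decompose_of_mem_ne deg hx hmn
  · intro x
    exact ⟨_, DirectSum.sum_support_decompose deg x⟩
  · intro x
    refine ⟨(DirectSum.decompose deg x).support, fun n hn => ?_⟩
    have : DirectSum.decompose deg x n = 0 := by simpa using hn
    exact congrArg Subtype.val this

variable (ℬ)

/-- The component of degree `n` of `B` with its generator placed in degree `d`. -/
def shiftDeg (d n : ℕ) : AddSubgroup B := if d ≤ n then ℬ (n - d) else ⊥

/-- The grading of the free module on generators `i` of degree `δ i`. -/
def freeDeg {I : Type u} (δ : I → ℕ) (n : ℕ) : AddSubgroup (I →₀ B) where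
  carrier := {f | ∀ i, f i ∈ shiftDeg ℬ (δ i) n}
  zero_mem' := fun i => (shiftDeg ℬ (δ i) n).zero_mem
  add_mem' := fun hf hg i => (shiftDeg ℬ (δ i) n).add_mem (hf i) (hg i)
  neg_mem' := fun hf i => (shiftDeg ℬ (δ i) n).neg_mem (hf i)

theorem freeDeg_isGraded [GradedRing ℬ] {I : Type u} (δ : I → ℕ) :
    IsGradedModule ℬ (freeDeg ℬ δ) := by
  classical
  obtain ⟨π, hmem, hsame, hdiff, hsum, hfin⟩ :=
    exists_proj ℬ (DirectSum.Decomposition.isInternal ℬ)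
  constructor
  · let σ : ℕ → ℕ → B →+ B := fun d n => if d ≤ n then π (n - d) else 0
    let Q : ℕ → (I →₀ B) →+ (I →₀ B) := fun n =>
      { toFun := fun f => Finsupp.onFinset f.support (fun i => σ (δ i) n (f i)) (by
          intro i hi
          rw [Finsupp.mem_support_iff]
          rintro h
          exact hi (by rw [h, map_zero]))
        map_zero' := by ext i; simp
        map_add' := by intro f g; ext i; simp }
    have hQ : ∀ n f i, Q n f i = σ (δ i) n (f i) := fun n f i => rfl
    refine isInternal_of_proj _ Q ?_ ?_ ?_ ?_
    · intro n f i
      rw [hQ]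
      by_cases h : δ i ≤ n
      · simpa [σ, shiftDeg, h] using hmem _ _
      · simp [σ, shiftDeg, h]
    · intro n f hf
      ext i
      have := hf i
      rw [hQ]
      by_cases h : δ i ≤ n
      · simp only [shiftDeg, h, if_true] at this
        simpa [σ, h] using hsame _ _ this
      · simp only [shiftDeg, h, if_false, AddSubgroup.mem_bot] at this
        simp [σ, h, this]
    · intro m n f hf hmn
      ext i
      have := hf i
      rw [hQ]
      by_cases h : δ i ≤ m
      · simp only [shiftDeg, h, if_true] at this
        by_cases h' : δ i ≤ n
        · simpa [σ, h'] using hdiff _ _ _ this (by omega)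
        · simp [σ, h']
      · simp only [shiftDeg, h, if_false, AddSubgroup.mem_bot] at this
        simp [this]
    · intro f
      choose s hs using fun b : B => hfin b
      let T : Finset ℕ := f.support.biUnion fun i => (s (f i)).image (fun k => k + δ i)
      refine ⟨T, ?_⟩
      ext i
      rw [Finsupp.finsetSum_apply]
      simp only [hQ]
      by_cases hi : f i = 0
      · simp [hi]
      · have hsub : (s (f i)).image (fun k => k + δ i) ⊆ T :=
          Finset.subset_biUnion_of_mem (fun i => (s (f i)).image (fun k => k + δ i))
            (Finsupp.mem_support_iff.2 hi)
        rw [← Finset.sum_subset hsub]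
        · rw [Finset.sum_image (by intro a _ b _ h; simpa using h)]
          simp only [σ, Nat.le_add_left, if_true, Nat.add_sub_cancel]
          obtain ⟨t, ht⟩ := hsum (f i)
          have h1 : ∑ k ∈ s (f i), π k (f i) = ∑ k ∈ s (f i) ∪ t, π k (f i) :=
            Finset.sum_subset Finset.subset_union_left fun k _ hk => hs _ _ hk
          have h2 : ∑ k ∈ t, π k (f i) = ∑ k ∈ s (f i) ∪ t, π k (f i) := by
            refine Finset.sum_subset Finset.subset_union_right fun k _ hk => ?_
            rw [← ht, map_sum]
            refine Finset.sum_eq_zero fun l hl => hdiff l k _ (hmem _ _) ?_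
            rintro rfl
            exact hk hl
          rw [h1, ← h2, ht]
        · intro n _ hn
          by_cases h : δ i ≤ n
          · simp only [σ, h, if_true]
            refine hs _ _ fun hmem => hn ?_
            exact Finset.mem_image.2 ⟨n - δ i, hmem, by omega⟩
          · simp [σ, h]
  · intro a c b f hb hf i
    have := hf i
    by_cases h : δ i ≤ c
    · have h' : δ i ≤ a + c := by omega
      simp only [shiftDeg, h, if_true] at this
      simp only [shiftDeg, h', if_true, Finsupp.smul_apply, smul_eq_mul]
      rw [Nat.add_sub_assoc h]
      exact SetLike.GradedMul.mul_mem hb this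
    · simp only [shiftDeg, h, if_false, AddSubgroup.mem_bot] at this
      simp [this]

variable {ℬ}

/-- The kernel of a homogeneous map, as a graded module. -/
def GrMod.ker {M N : GrMod ℬ} (f : M.carrier →ₗ[B] N.carrier) (hf : IsHomogeneousMap f) :
    GrMod ℬ where
  carrier := LinearMap.ker f
  deg := fun n => (M.deg n).comap (LinearMap.ker f).subtype.toAddMonoidHom
  isGraded := by
    obtain ⟨π, hmem, hsame, hdiff, hsum, -⟩ := exists_proj M.deg M.isGraded.isInternal
    obtain ⟨ρ, hmem', hsame', hdiff', hsum', -⟩ := exists_proj N.deg N.isGraded.isInternal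
    have hcomm : ∀ n x, f (π n x) = ρ n (f x) := by
      intro n x
      obtain ⟨s, hs⟩ := hsum x
      conv_rhs => rw [← hs]
      conv_lhs => rw [← hs]
      simp only [map_sum]
      refine Finset.sum_congr rfl fun k _ => ?_
      by_cases h : k = n
      · subst h
        rw [hsame _ _ (hmem _ _), hsame' _ _ (hf _ _ (hmem _ _))]
      · rw [hdiff _ _ _ (hmem _ _) h, hdiff' _ _ _ (hf _ _ (hmem _ _)) h, map_zero]
    constructor
    · let Q : ℕ → LinearMap.ker f →+ LinearMap.ker f := fun n =>
        { toFun := fun x => ⟨π n x, by rw [LinearMap.mem_ker, hcomm, x.2, map_zero]⟩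
          map_zero' := by ext; simp
          map_add' := by intro x y; ext; simp }
      refine isInternal_of_proj _ Q ?_ ?_ ?_ ?_
      · intro n x
        exact hmem n x
      · intro n x hx
        exact Subtype.ext (hsame n x hx)
      · intro m n x hx hmn
        exact Subtype.ext (hdiff m n x hx hmn)
      · intro x
        obtain ⟨s, hs⟩ := hsum x
        refine ⟨s, Subtype.ext ?_⟩
        rw [← hs]
        simp [Q, hs]
    · intro a c b m hb hm
      exact M.isGraded.smul_mem hb hm

/-- Every graded module is a homogeneous quotient of a graded projective one. -/
theorem exists_cover [GradedRing ℬ] (N : GrMod ℬ) :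
    ∃ (P : GrMod ℬ) (f : P.carrier →ₗ[B] N.carrier), Module.Projective B P.carrier ∧
      IsHomogeneousMap f ∧ Function.Surjective f := by
  classical
  let I : Type u := Σ n, N.deg n
  let v : I → N.carrier := fun i => i.2
  refine ⟨⟨I →₀ B, freeDeg ℬ (fun i => i.1), freeDeg_isGraded ℬ _⟩,
    Finsupp.linearCombination B v, inferInstanceAs (Module.Projective B (I →₀ B)), ?_, ?_⟩
  · intro n f hf
    change Finsupp.linearCombination B v f ∈ _
    rw [Finsupp.linearCombination_apply, Finsupp.sum]
    refine AddSubgroup.sum_mem _ fun i _ => ?_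
    have := hf i
    by_cases h : i.1 ≤ n
    · simp only [shiftDeg, h, if_true] at this
      have h2 := N.isGraded.smul_mem this i.2.2
      rwa [Nat.sub_add_cancel h] at h2
    · simp only [shiftDeg, h, if_false, AddSubgroup.mem_bot] at this
      rw [this, zero_smul]
      exact AddSubgroup.zero_mem _
  · intro x
    obtain ⟨π, hmem, -, -, hsum, -⟩ := exists_proj N.deg N.isGraded.isInternal
    obtain ⟨s, hs⟩ := hsum x
    refine ⟨∑ n ∈ s, Finsupp.single (⟨n, ⟨π n x, hmem n x⟩⟩ : I) 1, ?_⟩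
    rw [map_sum]
    simpa [v] using hs

/-- Every graded module has a graded projective resolution. -/
theorem nonempty_gradedProjRes [GradedRing ℬ] (N : GrMod ℬ) : Nonempty (GradedProjRes N) := by
  choose P f hproj hhom hsurj using fun M : GrMod ℬ => exists_cover M
  let Z : ℕ → GrMod ℬ := fun i =>
    Nat.rec (motive := fun _ => GrMod ℬ) N (fun _ M => GrMod.ker (f M) (hhom M)) i
  refine ⟨{
    X := fun i => P (Z i)
    projective := fun i => hproj _
    d := fun i => (LinearMap.ker (f (Z i))).subtype.comp
      (f (Z (i + 1)) : (P (Z (i + 1))).carrier →ₗ[B] LinearMap.ker (f (Z i)))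
    d_homogeneous := fun i n m hm => hhom (Z (i + 1)) n m hm
    aug := f N
    aug_homogeneous := hhom N
    aug_surjective := hsurj N
    exact_zero := ?_
    exact_succ := ?_ }⟩
  · intro x
    constructor
    · intro hx
      obtain ⟨y, hy⟩ := hsurj (Z 1) ⟨x, hx⟩
      exact ⟨y, congrArg Subtype.val hy⟩
    · rintro ⟨y, rfl⟩
      exact (f (Z 1) y).2
  · intro i x
    constructor
    · intro hx
      have hx' : f (Z (i + 1)) x = 0 := Subtype.ext hx
      obtain ⟨y, hy⟩ := hsurj (Z (i + 2)) ⟨x, hx'⟩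
      exact ⟨y, congrArg Subtype.val hy⟩
    · rintro ⟨y, rfl⟩
      have h : f (Z (i + 1)) (f (Z (i + 2)) y).1 = 0 := (f (Z (i + 2)) y).2
      exact congrArg Subtype.val h

end GradedModules

/-! ### Tor of graded modules -/

section Tor

variable {B : Type u} [Ring B] {ℬ : ℕ → AddSubgroup B}

/-- A chosen resolution by projective graded modules. -/
def gradedProjRes [GradedRing ℬ] (N : GrMod ℬ) : GradedProjRes N :=
  Classical.choice (nonempty_gradedProjRes N)

variable {M : Type u} [AddCommGroup M] [Module Bᵐᵒᵖ M] (degM : ℕ → AddSubgroup M)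

/-- The component of degree `j` of the graded abelian group `M ⊗_B N`, spanned by all `m ⊗ n` with
`m`, `n` homogeneous and `deg m + deg n = j`. -/
def tensorDeg (N : GrMod ℬ) (j : ℕ) : Submodule ℤ (BTensor B M N.carrier) :=
  Submodule.span ℤ {x | ∃ (a b : ℕ) (m : M) (n : N.carrier),
    a + b = j ∧ m ∈ degM a ∧ n ∈ N.deg b ∧ x = btmul B m n}

namespace GradedProjRes

variable {N : GrMod ℬ} (P : GradedProjRes N)

variable (M) in
/-- The differential of the complex `M ⊗_B P`. -/
def tensorD (i : ℕ) :
    BTensor B M (P.X (i + 1)).carrier →ₗ[ℤ] BTensor B M (P.X i).carrier :=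
  btmap B LinearMap.id (P.d i)

/-- The cycles of homological degree `i` and internal degree `j` in `M ⊗_B P`. -/
def cycles : (i j : ℕ) → Submodule ℤ (BTensor B M (P.X i).carrier)
  | 0, j => tensorDeg degM (P.X 0) j
  | i + 1, j => tensorDeg degM (P.X (i + 1)) j ⊓ LinearMap.ker (P.tensorD M i)

/-- The boundaries of homological degree `i` and internal degree `j` in `M ⊗_B P`. -/
def boundaries (i j : ℕ) : Submodule ℤ (BTensor B M (P.X i).carrier) :=
  (tensorDeg degM (P.X (i + 1)) j).map (P.tensorD M i)

/-- The homology of `M ⊗_B P` in homological degree `i` and internal degree `j`. -/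
abbrev homology (i j : ℕ) : Type u :=
  P.cycles degM i j ⧸ (P.boundaries degM i j).submoduleOf (P.cycles degM i j)

end GradedProjRes

/-- `Tor^B_{i,j}(M, N)` for a graded right `B`-module `M` and a graded left `B`-module `N`:
`i` is the homological and `j` the internal degree. -/
abbrev gradedTor [GradedRing ℬ] (N : GrMod ℬ) (i j : ℕ) : Type u :=
  (gradedProjRes N).homology degM i j

end Tor

/-! ### Left finitely projective Koszul graded rings -/

section Koszul

variable {R B : Type u} [Ring R] [Ring B]

/-- The ring homomorphism `η : R → B` identifies `R` with the component `B_0`. -/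
structure IsDegreeZero (η : R →+* B) (ℬ : ℕ → AddSubgroup B) : Prop where
  injective : Function.Injective η
  range_eq : Set.range η = (ℬ 0 : Set B)

variable (η : R →+* B) (ℬ : ℕ → AddSubgroup B)

/-- The left `R`-module `B_n`. -/
def component [GradedRing ℬ] (h : IsDegreeZero η ℬ) (n : ℕ) : Submodule R (LeftVia η) where
  carrier := {x | (show B from x) ∈ ℬ n}
  zero_mem' := (ℬ n).zero_mem
  add_mem' := fun hx hy => (ℬ n).add_mem hx hy
  smul_mem' := fun r x hx => by
    have hr : η r ∈ ℬ 0 := by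
      rw [← SetLike.mem_coe, ← h.range_eq]
      exact ⟨r, rfl⟩
    have := SetLike.GradedMul.mul_mem hr hx
    rwa [zero_add] at this

variable {η ℬ}

/-- The isomorphism of `R` with `B_0`. -/
def IsDegreeZero.equiv [GradedRing ℬ] (h : IsDegreeZero η ℬ) : R ≃+* ℬ 0 :=
  RingEquiv.ofBijective
    ({ toFun := fun r => ⟨η r, by rw [← SetLike.mem_coe, ← h.range_eq]; exact ⟨r, rfl⟩⟩
       map_one' := Subtype.ext (map_one η)
       map_mul' := fun x y => Subtype.ext (map_mul η x y)
       map_zero' := Subtype.ext (map_zero η)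
       map_add' := fun x y => Subtype.ext (map_add η x y) } : R →+* ℬ 0)
    ⟨fun x y hxy => h.injective (congrArg Subtype.val hxy), fun y => by
      have hy : (y : B) ∈ Set.range η := by rw [h.range_eq]; exact y.2
      obtain ⟨r, hr⟩ := hy
      exact ⟨r, Subtype.ext hr⟩⟩

/-- The augmentation `B → B_0 ≅ R` with kernel the ideal of elements of positive degree. -/
def IsDegreeZero.augmentation [GradedRing ℬ] (h : IsDegreeZero η ℬ) : B →+* R :=
  (h.equiv.symm : ℬ 0 →+* R).comp (GradedRing.projZeroRingHom' ℬ)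

/-- The grading of an abelian group concentrated in degree zero. -/
def degZero (M : Type u) [AddCommGroup M] (n : ℕ) : AddSubgroup M := if n = 0 then ⊤ else ⊥

theorem IsDegreeZero.augmentation_unit [GradedRing ℬ] (h : IsDegreeZero η ℬ) (r : R) :
    h.augmentation (η r) = r := by
  have h1 : GradedRing.projZeroRingHom' ℬ (η r) = h.equiv r :=
    GradedRing.projZeroRingHom'_apply_coe ℬ (h.equiv r)
  change h.equiv.symm (GradedRing.projZeroRingHom' ℬ (η r)) = r
  rw [h1, RingEquiv.symm_apply_apply]

theorem IsDegreeZero.augmentation_of_pos [GradedRing ℬ] (h : IsDegreeZero η ℬ) {n : ℕ}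
    (hn : n ≠ 0) {b : B} (hb : b ∈ ℬ n) : h.augmentation b = 0 := by
  have h1 : GradedRing.projZeroRingHom' ℬ b = 0 := by
    ext
    rw [GradedRing.coe_projZeroRingHom'_apply, GradedRing.projZeroRingHom_apply]
    exact DirectSum.decompose_of_mem_ne ℬ hb hn
  change h.equiv.symm (GradedRing.projZeroRingHom' ℬ b) = 0
  rw [h1, map_zero]

theorem degZero_isInternal (M : Type u) [AddCommGroup M] : DirectSum.IsInternal (degZero M) := by
  refine isInternal_of_proj _ (fun n => if n = 0 then AddMonoidHom.id M else 0) ?_ ?_ ?_ ?_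
  · intro n x
    by_cases h : n = 0 <;> simp [degZero, h]
  · intro n x hx
    by_cases h : n = 0
    · simp [h]
    · simp only [degZero, h, if_false, AddSubgroup.mem_bot] at hx
      simp [hx]
  · intro m n x hx hmn
    by_cases h : n = 0
    · have hm : m ≠ 0 := fun hm => hmn (hm.trans h.symm)
      simp only [degZero, hm, if_false, AddSubgroup.mem_bot] at hx
      simp [hx]
    · simp [h]
  · intro x
    exact ⟨{0}, by simp⟩

/-- `R` as a graded left `B`-module concentrated in degree zero, via the augmentation. -/
def IsDegreeZero.trivialModule [GradedRing ℬ] (h : IsDegreeZero η ℬ) : GrMod ℬ where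
  carrier := LeftVia h.augmentation
  deg := degZero (LeftVia h.augmentation)
  isGraded := by
    refine ⟨degZero_isInternal _, ?_⟩
    intro a c b m hb hm
    by_cases hc : c = 0
    · by_cases ha : a = 0
      · simp [degZero, ha, hc]
      · have : b • m = 0 := by
          change h.augmentation b * (show R from m) = 0
          rw [h.augmentation_of_pos ha hb, zero_mul]
        rw [this]
        exact AddSubgroup.zero_mem _
    · simp only [degZero, hc, if_false, AddSubgroup.mem_bot] at hm
      rw [hm, smul_zero]
      exact AddSubgroup.zero_mem _

/-- The group `Tor^B_{i,j}(R, R)`. -/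
abbrev IsDegreeZero.tor [GradedRing ℬ] (h : IsDegreeZero η ℬ) (i j : ℕ) : Type u :=
  gradedTor (degZero (RightVia h.augmentation)) h.trivialModule i j

variable (η ℬ)

/-- The graded ring `B` with `B_0 = R` is left finitely generated projective. -/
def IsLeftFGProjective [GradedRing ℬ] (h : IsDegreeZero η ℬ) : Prop :=
  ∀ n, Module.Finite R (component η ℬ h n) ∧ Module.Projective R (component η ℬ h n)

/-- The graded ring `B` with `B_0 = R` is left flat Koszul. -/
structure IsLeftFlatKoszul [GradedRing ℬ] (h : IsDegreeZero η ℬ) : Prop where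
  flat : ∀ n, IsLeftFlat R (component η ℬ h n)
  tor_eq_zero : ∀ i j, i ≠ j → Subsingleton (h.tor i j)

/-- The graded ring `B` is left finitely projective Koszul over `R`, where `η : R → B`
identifies `R` with `B_0`. -/
structure IsLeftFinProjKoszul [GradedRing ℬ] : Prop where
  degreeZero : IsDegreeZero η ℬ
  fgProjective : IsLeftFGProjective η ℬ degreeZero
  flatKoszul : IsLeftFlatKoszul η ℬ degreeZero

end Koszul

/-! ### Filtered rings and associated graded rings -/

section Filtered

variable {A : Type u} [Ring A]

/-- `F 0 ⊆ F 1 ⊆ ⋯` is a filtration making `A` a filtered ring. -/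
structure IsRingFilt (F : ℕ → AddSubgroup A) : Prop where
  mono : Monotone F
  one_mem : (1 : A) ∈ F 0
  mul_mem : ∀ {m n : ℕ} {x y : A}, x ∈ F m → y ∈ F n → x * y ∈ F (m + n)

/-- `F (n - 1)`, where `F (-1) = 0`. -/
def prevFilt (F : ℕ → AddSubgroup A) : ℕ → AddSubgroup A
  | 0 => ⊥
  | n + 1 => F n

/-- The piece `F n / F (n - 1)` of the associated graded ring. -/
def GrPiece {F : ℕ → AddSubgroup A} (_hF : IsRingFilt F) (n : ℕ) : Type u :=
  F n ⧸ (prevFilt F n).addSubgroupOf (F n)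

variable {F : ℕ → AddSubgroup A} (hF : IsRingFilt F)

instance (n : ℕ) : AddCommGroup (GrPiece hF n) :=
  inferInstanceAs (AddCommGroup (F n ⧸ (prevFilt F n).addSubgroupOf (F n)))

/-- The class of `x ∈ F n` in `F n / F (n - 1)`. -/
def symb (n : ℕ) : F n →+ GrPiece hF n := QuotientAddGroup.mk' _

theorem symb_surjective (n : ℕ) : Function.Surjective (symb hF n) :=
  QuotientAddGroup.mk'_surjective _

theorem symb_eq_zero {n : ℕ} {x : F n} : symb hF n x = 0 ↔ (x : A) ∈ prevFilt F n :=
  QuotientAddGroup.eq_zero_iff (N := (prevFilt F n).addSubgroupOf (F n)) x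

theorem mul_mem_prev_left (hF : IsRingFilt F) {m n : ℕ} {x y : A} (hx : x ∈ prevFilt F m) (hy : y ∈ F n) :
    x * y ∈ prevFilt F (m + n) := by
  cases m with
  | zero =>
    rw [show x = 0 from hx, zero_mul]
    exact AddSubgroup.zero_mem _
  | succ m =>
    have := hF.mul_mem (show x ∈ F m from hx) hy
    rw [show m + 1 + n = (m + n) + 1 by omega]
    exact this

theorem mul_mem_prev_right (hF : IsRingFilt F) {m n : ℕ} {x y : A} (hx : x ∈ F m) (hy : y ∈ prevFilt F n) :
    x * y ∈ prevFilt F (m + n) := by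
  cases n with
  | zero =>
    rw [show y = 0 from hy, mul_zero]
    exact AddSubgroup.zero_mem _
  | succ n => exact hF.mul_mem hx (show y ∈ F n from hy)

/-- The multiplication of the associated graded ring, induced by that of `A`. -/
def grMul (m n : ℕ) : GrPiece hF m →+ GrPiece hF n →+ GrPiece hF (m + n) :=
  QuotientAddGroup.lift ((prevFilt F m).addSubgroupOf (F m))
    { toFun := fun x => QuotientAddGroup.lift ((prevFilt F n).addSubgroupOf (F n))
        { toFun := fun y => symb hF (m + n) ⟨x * y, hF.mul_mem x.2 y.2⟩
          map_zero' := (symb_eq_zero hF).2 (by simp)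
          map_add' := fun y y' => by
            rw [← map_add]
            exact congrArg _ (Subtype.ext (mul_add _ _ _)) }
        (fun _ hy => (symb_eq_zero hF).2 (mul_mem_prev_right hF x.2 hy))
      map_zero' := by
        refine AddMonoidHom.ext fun y => ?_
        obtain ⟨y, rfl⟩ := symb_surjective hF n y
        exact (symb_eq_zero hF).2 (by simp)
      map_add' := fun x x' => by
        refine AddMonoidHom.ext fun y => ?_
        obtain ⟨y, rfl⟩ := symb_surjective hF n y
        change symb hF (m + n) _ = symb hF (m + n) _ + symb hF (m + n) _
        rw [← map_add]
        exact congrArg _ (Subtype.ext (add_mul _ _ _)) }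
    (fun x hx => by
      refine AddMonoidHom.ext fun y => ?_
      obtain ⟨y, rfl⟩ := symb_surjective hF n y
      exact (symb_eq_zero hF).2 (mul_mem_prev_left hF hx y.2))

theorem grMul_symb {m n : ℕ} (x : F m) (y : F n) :
    grMul hF m n (symb hF m x) (symb hF n y) =
      symb hF (m + n) ⟨x * y, hF.mul_mem x.2 y.2⟩ := rfl

theorem mk_symb_eq {m n : ℕ} (h : m = n) {x : F m} {y : F n} (hxy : (x : A) = y) :
    (GradedMonoid.mk m (symb hF m x) : GradedMonoid (GrPiece hF)) =
      GradedMonoid.mk n (symb hF n y) := by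
  subst h
  rw [Subtype.ext hxy]

/-- The unit of the associated graded ring. -/
def grOne : GrPiece hF 0 := symb hF 0 ⟨1, hF.one_mem⟩

instance : GradedMonoid.GMul (GrPiece hF) where
  mul := fun x y => grMul hF _ _ x y

instance : GradedMonoid.GOne (GrPiece hF) where
  one := grOne hF

instance : DirectSum.GRing (GrPiece hF) where
  mul_zero := fun x => map_zero _
  zero_mul := fun y => by
    change grMul hF _ _ 0 y = 0
    rw [map_zero, AddMonoidHom.zero_apply]
  mul_add := fun x => map_add _
  add_mul := fun x x' y => by
    change grMul hF _ _ (x + x') y = _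
    rw [map_add, AddMonoidHom.add_apply]
    rfl
  one_mul := by
    rintro ⟨n, x⟩
    obtain ⟨x, rfl⟩ := symb_surjective hF n x
    exact mk_symb_eq hF (zero_add n) (one_mul (x : A))
  mul_one := by
    rintro ⟨n, x⟩
    obtain ⟨x, rfl⟩ := symb_surjective hF n x
    exact mk_symb_eq hF (add_zero n) (mul_one (x : A))
  mul_assoc := by
    rintro ⟨m, x⟩ ⟨n, y⟩ ⟨k, z⟩
    obtain ⟨x, rfl⟩ := symb_surjective hF m x
    obtain ⟨y, rfl⟩ := symb_surjective hF n y
    obtain ⟨z, rfl⟩ := symb_surjective hF k z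
    exact mk_symb_eq hF (add_assoc m n k) (mul_assoc (x : A) y z)
  natCast := fun n => n • grOne hF
  natCast_zero := zero_smul _ _
  natCast_succ := fun n => by
    rw [add_smul, one_smul]
    rfl
  intCast := fun n => n • grOne hF
  intCast_ofNat := fun n => natCast_zsmul _ _
  intCast_negSucc_ofNat := fun n => negSucc_zsmul _ _

/-- The associated graded ring `⨁ n, F n / F (n - 1)`. -/
abbrev AssocGr : Type u := DirectSum ℕ (GrPiece hF)

/-- The component of degree `n` of the associated graded ring. -/
def grDeg (n : ℕ) : AddSubgroup (AssocGr hF) := (DirectSum.of (GrPiece hF) n).range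

/-- The isomorphism of `F n / F (n - 1)` with the component of degree `n`. -/
def toGrDeg (n : ℕ) : GrPiece hF n →+ grDeg hF n where
  toFun := fun x => ⟨DirectSum.of (GrPiece hF) n x, ⟨x, rfl⟩⟩
  map_zero' := Subtype.ext (map_zero _)
  map_add' := fun x y => Subtype.ext (map_add _ x y)

instance : GradedRing (grDeg hF) where
  one_mem := ⟨grOne hF, rfl⟩
  mul_mem := by
    rintro m n _ _ ⟨x, rfl⟩ ⟨y, rfl⟩
    exact ⟨_, (DirectSum.of_mul_of x y).symm⟩
  decompose' := DirectSum.toAddMonoid fun n =>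
    (DirectSum.of (fun n => grDeg hF n) n).comp (toGrDeg hF n)
  left_inv := fun x => by
    induction x using DirectSum.induction_on with
    | zero => simp
    | of n x =>
      rw [DirectSum.toAddMonoid_of, AddMonoidHom.comp_apply, DirectSum.coeAddMonoidHom_of]
      rfl
    | add x y hx hy => rw [map_add, map_add, hx, hy]
  right_inv := fun x => by
    induction x using DirectSum.induction_on with
    | zero => simp
    | of n x =>
      obtain ⟨_, x, rfl⟩ := x
      rw [DirectSum.coeAddMonoidHom_of, DirectSum.toAddMonoid_of]
      rfl
    | add x y hx hy => rw [map_add, map_add, hx, hy]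

/-- The ring homomorphism `R → F 0 → gr A` induced by a ring homomorphism `R → A` with image
in `F 0`. -/
def grUnit {R : Type u} [Ring R] (φ : R →+* A) (hφ : ∀ r, φ r ∈ F 0) : R →+* AssocGr hF where
  toFun := fun r => DirectSum.of (GrPiece hF) 0 (symb hF 0 ⟨φ r, hφ r⟩)
  map_one' := congrArg (fun x => DirectSum.of (GrPiece hF) 0 (symb hF 0 x))
    (Subtype.ext (map_one φ))
  map_mul' := fun r s => by
    rw [DirectSum.of_mul_of]
    exact congrArg (fun x => DirectSum.of (GrPiece hF) 0 (symb hF 0 x))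
      (Subtype.ext (map_mul φ r s))
  map_zero' := by
    rw [show (⟨φ 0, hφ 0⟩ : F 0) = 0 from Subtype.ext (map_zero φ), map_zero, map_zero]
  map_add' := fun r s => by
    rw [← map_add, ← map_add]
    exact congrArg (fun x => DirectSum.of (GrPiece hF) 0 (symb hF 0 x))
      (Subtype.ext (map_add φ r s))

end Filtered

/-! ### Rings of the form `R ⊗_K C` -/

section HalfBaseChange

variable {K R C A : Type u} [Ring K] [Ring R] [Ring C] [Ring A]

/-- The map `R ⊗_K C → A`, `r ⊗ c ↦ r c`, for a commutative square of ring homomorphisms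
`K → C → A` and `K → R → A`. -/
def productMap (ηC : K →+* C) (ηR : K →+* R) (ιC : C →+* A) (ηA : R →+* A)
    (hcomm : ηA.comp ηR = ιC.comp ηC) :
    BTensor K (RightVia ηR) (LeftVia ηC) →ₗ[ℤ] A :=
  Submodule.liftQ _
    (TensorProduct.lift (LinearMap.mk₂ ℤ
      (fun (r : RightVia ηR) (c : LeftVia ηC) => ηA (show R from r) * ιC (show C from c))
      (fun r r' c => by
        rw [← add_mul, ← map_add]
        rfl)
      (fun n r c => by
        rw [← smul_mul_assoc, ← map_zsmul]
        rfl)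
      (fun r c c' => by
        rw [← mul_add, ← map_add]
        rfl)
      (fun n r c => by
        rw [← mul_smul_comm, ← map_zsmul]
        rfl))) <| by
    rw [balancedRel, Submodule.span_le]
    rintro _ ⟨r, k, c, rfl⟩
    change TensorProduct.lift _ _ = 0
    rw [map_sub, TensorProduct.lift.tmul, TensorProduct.lift.tmul, sub_eq_zero]
    change ηA ((show R from r) * ηR k) * ιC (show C from c) =
      ηA (show R from r) * ιC (ηC k * (show C from c))
    rw [map_mul, map_mul, mul_assoc]
    congr 2
    exact RingHom.congr_fun hcomm k

@[simp]
theorem productMap_btmul (ηC : K →+* C) (ηR : K →+* R) (ιC : C →+* A) (ηA : R →+* A)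
    (hcomm : ηA.comp ηR = ιC.comp ηC) (r : R) (c : C) :
    productMap ηC ηR ιC ηA hcomm (btmul K (show RightVia ηR from r) (show LeftVia ηC from c)) =
      ηA r * ιC c := rfl

/-- The length filtration `F n = C_0 ⊕ ⋯ ⊕ C_n` of a graded ring. -/
def lengthFilt (𝒞 : ℕ → AddSubgroup C) (n : ℕ) : AddSubgroup C :=
  ⨆ (i : ℕ) (_ : i ≤ n), 𝒞 i

/-- The filtration `F n A = R ⊗_K F n C` of `A ≅ R ⊗_K C`, as the subgroup of `A` generated by all
products `r c` with `r ∈ R` and `c ∈ F n C`. -/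
def productFilt (ιC : C →+* A) (ηA : R →+* A) (𝒞 : ℕ → AddSubgroup C) (n : ℕ) : AddSubgroup A :=
  AddSubgroup.closure {a | ∃ (r : R) (c : C), c ∈ lengthFilt 𝒞 n ∧ a = ηA r * ιC c}

theorem unit_mem_productFilt (ιC : C →+* A) (ηA : R →+* A) (𝒞 : ℕ → AddSubgroup C)
    [GradedRing 𝒞] (r : R) : ηA r ∈ productFilt ιC ηA 𝒞 0 :=
  AddSubgroup.subset_closure ⟨r, 1,
    (le_iSup₂_of_le 0 le_rfl le_rfl : 𝒞 0 ≤ lengthFilt 𝒞 0) SetLike.GradedOne.one_mem, by simp⟩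

end HalfBaseChange

end RelKoszul
end

noncomputable section

namespace RelKoszul

/-! ### The tensor product over a noncommutative ring -/

section Tensor

variable {K : Type u} [Ring K] {M M' N N' N'' : Type u}
  [AddCommGroup M] [Module Kᵐᵒᵖ M] [AddCommGroup M'] [Module Kᵐᵒᵖ M']
  [AddCommGroup N] [Module K N] [AddCommGroup N'] [Module K N'] [AddCommGroup N''] [Module K N'']

/-! The heart of the matter is that the associated graded ring of `A` is again of the form `R ⊗_K
C`, now compatibly with gradings. Sending `c ∈ C_n` to its class in `F_n A / F_{n-1} A` gives a
graded ring homomorphism `C → gr A`, and the product map `R ⊗_K C → gr A` is bijective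
(`isGradedBaseChange_assocGr`). This holds because `C` is the direct sum of the `C_n` as a left
`K`-module: the projections `id ⊗ p_n` decompose `R ⊗_K C`, the `n`-th one kills what corresponds to
`F_{n-1} A`, and `F_n A` is generated modulo `F_{n-1} A` by products `r c` with `c ∈ C_n`.

It remains to show that the Koszul property passes from `C` to a graded ring `B ≅ R ⊗_K C` with `R`
in degree zero (`IsGradedBaseChange.isLeftFinProjKoszul`). The augmentation of `C` yields `B_0 = R`.
A finite dual basis of `C_n` over `K` extends to one of `B_n` over `R`, so `B_n` is finitely
generated projective, and hence flat.

For Tor, let `F` be a graded free resolution of `K` over `C`. As `R` is right flat over `K`, `R ⊗_K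
F` is a graded free resolution of `R` over `B` (`baseChangeRes`); its differentials are the matrices
of `F` with entries pushed along `C → B`. Applying `R ⊗_B -` to it gives the same complex as
applying `R ⊗_K -` to `K ⊗_C F`, since both reduce the matrix entries along the same homomorphism `C
→ R`. Flatness then carries exactness from one to the other, separately in every bidegree
(`subsingleton_tor`). Since Tor is defined by a chosen projective resolution, the passage to free
ones rests on the comparison theorem for graded resolutions (`subsingleton_homology_of`). -/

theorem btmul_add (m : M) (n n' : N) : btmul K m (n + n') = btmul K m n + btmul K m n' := by
  rw [btmul, TensorProduct.tmul_add, map_add]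
  rfl

theorem add_btmul (m m' : M) (n : N) : btmul K (m + m') n = btmul K m n + btmul K m' n := by
  rw [btmul, TensorProduct.add_tmul, map_add]
  rfl

theorem btmul_zero (m : M) : btmul K m (0 : N) = 0 := by
  rw [btmul, TensorProduct.tmul_zero, map_zero]

theorem smul_btmul (k : K) (m : M) (n : N) :
    btmul K (MulOpposite.op k • m) n = btmul K m (k • n) := by
  rw [← sub_eq_zero, btmul, btmul, ← map_sub, ← LinearMap.mem_ker, Submodule.ker_mkQ]
  exact Submodule.subset_span ⟨m, k, n, rfl⟩

theorem BTensor.induction {p : BTensor K M N → Prop} (x : BTensor K M N) (zero : p 0)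
    (btmul : ∀ m n, p (btmul K m n)) (add : ∀ x y, p x → p y → p (x + y)) : p x := by
  obtain ⟨x, rfl⟩ := Submodule.mkQ_surjective _ x
  induction x using TensorProduct.induction_on with
  | zero => simpa using zero
  | tmul m n => exact btmul m n
  | add x y hx hy => rw [map_add]; exact add _ _ hx hy

theorem BTensor.hom_ext {G : Type*} [AddCommGroup G] {f g : BTensor K M N →+ G}
    (h : ∀ m n, f (btmul K m n) = g (btmul K m n)) : f = g := by
  refine DFunLike.ext f g fun x => ?_
  induction x using BTensor.induction with
  | zero => rw [map_zero, map_zero]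
  | btmul m n => exact h m n
  | add x y hx hy => rw [map_add, map_add, hx, hy]

/-- The additive map on `M ⊗_K N` given by a balanced biadditive map. -/
def BTensor.lift {G : Type*} [AddCommGroup G] (f : M →+ N →+ G)
    (hf : ∀ m (k : K) n, f (MulOpposite.op k • m) n = f m (k • n)) : BTensor K M N →+ G :=
  (Submodule.liftQ (balancedRel K M N)
    (TensorProduct.liftAddHom f (fun r m n => by
      rw [map_zsmul, map_zsmul]; rfl) : M ⊗[ℤ] N →+ G).toIntLinearMap (by
    rw [balancedRel, Submodule.span_le]
    rintro _ ⟨m, k, n, rfl⟩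
    exact LinearMap.mem_ker.2 ((map_sub _ _ _).trans (sub_eq_zero.2 (hf m k n))))).toAddMonoidHom

variable (M) in
/-- The map `M ⊗ f : M ⊗_K N → M ⊗_K N'` induced by a linear map `f`. -/
def btmapRight (f : N →ₗ[K] N') : BTensor K M N →+ BTensor K M N' :=
  (btmap K (LinearMap.id : M →ₗ[Kᵐᵒᵖ] M) f).toAddMonoidHom

@[simp]
theorem btmapRight_btmul (f : N →ₗ[K] N') (m : M) (n : N) :
    btmapRight M f (btmul K m n) = btmul K m (f n) := rfl

theorem btmapRight_comp (g : N' →ₗ[K] N'') (f : N →ₗ[K] N') (x : BTensor K M N) :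
    btmapRight M (g ∘ₗ f) x = btmapRight M g (btmapRight M f x) :=
  DFunLike.congr_fun (f := btmapRight M (g ∘ₗ f))
    (g := (btmapRight M g).comp (btmapRight M f)) (BTensor.hom_ext fun _ _ => rfl) x

theorem btmapRight_id (x : BTensor K M N) : btmapRight M LinearMap.id x = x :=
  DFunLike.congr_fun (f := btmapRight M LinearMap.id)
    (g := AddMonoidHom.id _) (BTensor.hom_ext fun _ _ => rfl) x

theorem btmapRight_add (f g : N →ₗ[K] N') (x : BTensor K M N) :
    btmapRight M (f + g) x = btmapRight M f x + btmapRight M g x :=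
  DFunLike.congr_fun (f := btmapRight M (f + g))
    (g := btmapRight M f + btmapRight M g) (BTensor.hom_ext fun _ _ => btmul_add _ _ _) x

theorem btmapRight_zero (x : BTensor K M N) : btmapRight M (0 : N →ₗ[K] N') x = 0 :=
  DFunLike.congr_fun (f := btmapRight M (0 : N →ₗ[K] N'))
    (g := 0) (BTensor.hom_ext fun _ _ => btmul_zero _) x

theorem btmapRight_comp_btmap (g : M →ₗ[Kᵐᵒᵖ] M') (f : N →ₗ[K] N') (x : BTensor K M N) :
    btmapRight M' f (btmap K g LinearMap.id x) = btmap K g LinearMap.id (btmapRight M f x) :=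
  DFunLike.congr_fun
    (f := (btmapRight M' f).comp (btmap K g LinearMap.id).toAddMonoidHom)
    (g := (btmap K g LinearMap.id).toAddMonoidHom.comp (btmapRight M f))
    (BTensor.hom_ext fun _ _ => rfl) x

variable (K M) in
/-- The isomorphism `M ⊗_K K ≅ M`. -/
def BTensor.selfEquiv : BTensor K M K ≃+ M :=
  AddMonoidHom.toAddEquiv
    (BTensor.lift
      (AddMonoidHom.mk' (fun m => AddMonoidHom.mk' (fun k : K => MulOpposite.op k • m)
          (fun k k' => by rw [MulOpposite.op_add, add_smul]))
        (fun m m' => by ext k; exact smul_add _ _ _))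
      (fun m k k' => by
        change MulOpposite.op k' • MulOpposite.op k • m = MulOpposite.op (k * k') • m
        rw [smul_smul, ← MulOpposite.op_mul]))
    (AddMonoidHom.mk' (fun m => btmul K m 1) (fun m m' => add_btmul _ _ _))
    (BTensor.hom_ext fun m k => by
      change btmul K (MulOpposite.op k • m) 1 = btmul K m k
      rw [smul_btmul, smul_eq_mul, mul_one])
    (by ext m; exact one_smul _ m)

/-- The map `M ⊗_K N^(I) → T^(I)` induced by a map `M ⊗_K N → T`. -/
def BTensor.finsuppHom (I : Type u) {T : Type*} [AddCommGroup T] (e : BTensor K M N →+ T) :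
    BTensor K M (I →₀ N) →+ (I →₀ T) :=
  BTensor.lift
    (AddMonoidHom.mk' (fun m => Finsupp.mapRange.addMonoidHom
        (AddMonoidHom.mk' (fun n => e (btmul K m n))
          (fun n n' => by rw [btmul_add, map_add])))
      (fun m m' => by
        refine AddMonoidHom.ext fun f => Finsupp.ext fun i => ?_
        change e (btmul K (m + m') (f i)) = e (btmul K m (f i)) + e (btmul K m' (f i))
        rw [add_btmul, map_add]))
    (fun m k f => Finsupp.ext fun i => by
      change e (btmul K (MulOpposite.op k • m) (f i)) = e (btmul K m (k • f i))
      rw [smul_btmul])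

theorem BTensor.finsuppHom_btmul (I : Type u) {T : Type*} [AddCommGroup T]
    (e : BTensor K M N →+ T) (m : M) (f : I →₀ N) (i : I) :
    BTensor.finsuppHom I e (btmul K m f) i = e (btmul K m (f i)) := rfl

/-- Computing the map on each summand is what shows that it is inverse to the map assembled from the
summand inclusions. -/
theorem BTensor.finsuppHom_single (I : Type u) {T : Type*} [AddCommGroup T]
    (e : BTensor K M N →+ T) (i : I) (x : BTensor K M N) :
    BTensor.finsuppHom I e (btmapRight M (Finsupp.lsingle i) x) = Finsupp.single i (e x) := by
  classical
  induction x using BTensor.induction with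
  | zero => simp only [map_zero, Finsupp.single_zero]
  | add x y hx hy => rw [map_add, map_add, map_add, hx, hy, Finsupp.single_add]
  | btmul m n =>
    ext j
    rw [btmapRight_btmul, finsuppHom_btmul, Finsupp.lsingle_apply, Finsupp.single_apply,
      Finsupp.single_apply]
    split_ifs
    · rfl
    · rw [btmul_zero, map_zero]

/-- The isomorphism `M ⊗_K N^(I) ≅ T^(I)` induced by an isomorphism `M ⊗_K N ≅ T`. -/
def BTensor.finsuppEquiv (I : Type u) {T : Type*} [AddCommGroup T] (e : BTensor K M N ≃+ T) :
    BTensor K M (I →₀ N) ≃+ (I →₀ T) :=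
  AddMonoidHom.toAddEquiv (BTensor.finsuppHom I e.toAddMonoidHom)
    (Finsupp.liftAddHom fun i =>
      (btmapRight M (Finsupp.lsingle i)).comp e.symm.toAddMonoidHom)
    (BTensor.hom_ext fun m f => by
      rw [AddMonoidHom.comp_apply, AddMonoidHom.id_apply]
      induction f using Finsupp.induction_linear with
      | zero => rw [btmul_zero, map_zero, map_zero]
      | add f g hf hg => rw [btmul_add, map_add, map_add, hf, hg]
      | single i n =>
        have h := finsuppHom_single I e.toAddMonoidHom i (btmul K m n)
        rw [btmapRight_btmul, Finsupp.lsingle_apply] at h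
        rw [h, Finsupp.liftAddHom_apply_single]
        change btmapRight M _ (e.symm (e (btmul K m n))) = _
        rw [e.symm_apply_apply, btmapRight_btmul, Finsupp.lsingle_apply])
    (Finsupp.addHom_ext fun i t => by
      rw [AddMonoidHom.comp_apply, Finsupp.liftAddHom_apply_single, AddMonoidHom.comp_apply,
        finsuppHom_single]
      exact congrArg _ (e.apply_symm_apply t))

/-! ### Exactness -/

/-- The tensor product is right exact. -/
theorem btmapRight_exact_of_surjective {f : N →ₗ[K] N'} {g : N' →ₗ[K] N''}
    (hfg : ∀ y, g y = 0 → ∃ x, f x = y) (hg : Function.Surjective g) {x : BTensor K M N'}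
    (hx : btmapRight M g x = 0) : ∃ y, btmapRight M f y = x := by
  -- Modulo the image of `M ⊗ f`, the class of `m ⊗ y` depends only on `g y`. Choosing preimages
  -- under `g` therefore gives a well-defined map `ψ` from `M ⊗ N''` to the cokernel, and `ψ`
  -- composed with `M ⊗ g` is the quotient map.
  let Q := BTensor K M N' ⧸ (btmapRight M f).range
  let q : BTensor K M N' →+ Q := QuotientAddGroup.mk' _
  have hq : ∀ (m : M) (y y' : N'), g y = g y' → q (btmul K m y) = q (btmul K m y') := by
    intro m y y' h
    obtain ⟨z, hz⟩ := hfg (y - y') (by rw [map_sub, h, sub_self])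
    rw [← sub_add_cancel y y', btmul_add, map_add, add_eq_right]
    refine (QuotientAddGroup.eq_zero_iff _).2 ⟨btmul K m z, ?_⟩
    rw [btmapRight_btmul, hz]
  have hs := Function.surjInv_eq hg
  let ψ : BTensor K M N'' →+ Q := BTensor.lift
    (AddMonoidHom.mk' (fun m => AddMonoidHom.mk'
        (fun n => q (btmul K m (Function.surjInv hg n)))
        (fun n n' => by
          rw [← map_add, ← btmul_add]
          exact hq m _ _ (by rw [map_add, hs, hs, hs])))
      (fun m m' => by
        refine AddMonoidHom.ext fun n => ?_
        change q _ = q _ + q _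
        rw [← map_add, ← add_btmul]))
    (fun m k n => by
      change q _ = q _
      rw [smul_btmul]
      exact hq m _ _ (by rw [map_smul, hs, hs]))
  have hψ : ψ.comp (btmapRight M g) = q := BTensor.hom_ext fun m n => hq m _ _ (hs _)
  have hx' : q x = 0 := by rw [← hψ, AddMonoidHom.comp_apply, hx, map_zero]
  exact (QuotientAddGroup.eq_zero_iff x).1 hx'

/-- Tensoring with a flat module preserves exactness. -/
theorem IsRightFlat.exact (hM : IsRightFlat K M) {f : N →ₗ[K] N'} {g : N' →ₗ[K] N''}
    (hfg : ∀ y, g y = 0 → ∃ x, f x = y) {x : BTensor K M N'} (hx : btmapRight M g x = 0) :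
    ∃ y, btmapRight M f y = x := by
  -- Factor `g` through its range: right exactness handles the surjective factor, and flatness makes
  -- the inclusion of the range injective after tensoring.
  refine btmapRight_exact_of_surjective (g := g.rangeRestrict)
    (fun y hy => hfg y (congrArg Subtype.val hy)) g.surjective_rangeRestrict ?_
  apply hM _ _ (LinearMap.range g).subtype Subtype.val_injective
  change btmapRight M (LinearMap.range g).subtype (btmapRight M g.rangeRestrict x) =
    btmapRight M (LinearMap.range g).subtype 0
  rw [← btmapRight_comp, map_zero]
  exact hx

/-- Tensoring with a flat module preserves exactness at the intersection of two kernels. -/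
theorem IsRightFlat.exact_inf (hM : IsRightFlat K M) {N₁ N₂ : Type u} [AddCommGroup N₁]
    [Module K N₁] [AddCommGroup N₂] [Module K N₂] {f : N →ₗ[K] N'} {g₁ : N' →ₗ[K] N₁}
    {g₂ : N' →ₗ[K] N₂} (hfg : ∀ y, g₁ y = 0 → g₂ y = 0 → ∃ x, f x = y) {x : BTensor K M N'}
    (hx₁ : btmapRight M g₁ x = 0) (hx₂ : btmapRight M g₂ x = 0) :
    ∃ y, btmapRight M f y = x := by
  -- The intersection of the two kernels is the kernel of `(g₁, g₂) : N' → N₁ × N₂`.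
  refine hM.exact (g := LinearMap.inl K N₁ N₂ ∘ₗ g₁ + LinearMap.inr K N₁ N₂ ∘ₗ g₂) ?_ ?_
  · intro y hy
    have h1 := congrArg Prod.fst hy
    have h2 := congrArg Prod.snd hy
    exact hfg y (by simpa using h1) (by simpa using h2)
  · rw [btmapRight_add, btmapRight_comp, btmapRight_comp, hx₁, hx₂, map_zero, map_zero, add_zero]

/-! ### Projective modules are flat -/

/-- A projective module is a retract of a free one, and `M ⊗_K K^(P) ≅ M^(P)` turns `g ⊗ id` into
`g` applied in each coordinate, which is injective. The section `s` carries this back to `P`. -/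
theorem isLeftFlat_of_projective (P : Type u) [AddCommGroup P] [Module K P]
    [Module.Projective K P] : IsLeftFlat K P := by
  intro M M' _ _ _ _ g hg
  obtain ⟨s, hs⟩ := Module.projective_def'.1 ‹Module.Projective K P›
  let e := fun (M : Type u) [AddCommGroup M] [Module Kᵐᵒᵖ M] =>
    BTensor.finsuppEquiv P (BTensor.selfEquiv K M)
  have hnat : ∀ x : BTensor K M (P →₀ K), e M' (btmap K g LinearMap.id x) =
      Finsupp.mapRange g (map_zero g) (e M x) := by
    intro x
    refine DFunLike.congr_fun
      (f := (e M').toAddMonoidHom.comp (btmap K g LinearMap.id).toAddMonoidHom)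
      (g := (Finsupp.mapRange.addMonoidHom g.toAddMonoidHom).comp (e M).toAddMonoidHom)
      (BTensor.hom_ext fun m f => Finsupp.ext fun i => ?_) x
    exact (map_smul g _ _).symm
  rw [injective_iff_map_eq_zero]
  intro x hx
  have h1 : e M (btmapRight M s x) = 0 := by
    apply Finsupp.mapRange_injective g (map_zero g) hg
    rw [← hnat, ← btmapRight_comp_btmap, hx, map_zero, map_zero, Finsupp.mapRange_zero]
  rw [← btmapRight_id x, ← hs, btmapRight_comp, (map_eq_zero_iff _ (e M).injective).1 h1, map_zero]

end Tensor

/-! ### Comparison of graded projective resolutions -/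

section Comparison

variable {B : Type u} [Ring B] {ℬ : ℕ → AddSubgroup B}

theorem IsHomogeneousMap.comp {L M N : GrMod ℬ} {g : M.carrier →ₗ[B] N.carrier}
    {f : L.carrier →ₗ[B] M.carrier} (hg : IsHomogeneousMap g) (hf : IsHomogeneousMap f) :
    IsHomogeneousMap (g ∘ₗ f : L.carrier →ₗ[B] N.carrier) :=
  fun n m hm => hg n _ (hf n m hm)

theorem IsHomogeneousMap.id (M : GrMod ℬ) :
    IsHomogeneousMap (LinearMap.id : M.carrier →ₗ[B] M.carrier) :=
  fun _ _ hm => hm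

theorem IsHomogeneousMap.sub {M N : GrMod ℬ} {f g : M.carrier →ₗ[B] N.carrier}
    (hf : IsHomogeneousMap f) (hg : IsHomogeneousMap g) : IsHomogeneousMap (f - g) :=
  fun n m hm => (N.deg n).sub_mem (hf n m hm) (hg n m hm)

/-- Additive maps that agree on all homogeneous elements are equal. -/
theorem eq_of_eq_on_deg {M : Type u} [AddCommGroup M] {deg : ℕ → AddSubgroup M}
    (h : DirectSum.IsInternal deg) {G : Type*} [AddCommGroup G] {f g : M →+ G}
    (hfg : ∀ n, ∀ x ∈ deg n, f x = g x) : f = g := by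
  obtain ⟨π, hmem, -, -, hsum, -⟩ := exists_proj deg h
  ext x
  obtain ⟨s, hs⟩ := hsum x
  rw [← hs, map_sum, map_sum]
  exact Finset.sum_congr rfl fun n _ => hfg n _ (hmem n x)

/-- Homogeneous maps commute with the projections on the components. -/
theorem map_proj {M N : Type u} [AddCommGroup M] [AddCommGroup N] {deg : ℕ → AddSubgroup M}
    {deg' : ℕ → AddSubgroup N} (h : DirectSum.IsInternal deg) (f : M →+ N)
    (hf : ∀ n, ∀ x ∈ deg n, f x ∈ deg' n) {π : ℕ → M →+ M} {ρ : ℕ → N →+ N}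
    (hsame : ∀ n x, x ∈ deg n → π n x = x)
    (hdiff : ∀ m n x, x ∈ deg m → m ≠ n → π n x = 0)
    (hsame' : ∀ n x, x ∈ deg' n → ρ n x = x)
    (hdiff' : ∀ m n x, x ∈ deg' m → m ≠ n → ρ n x = 0) (n : ℕ) (x : M) :
    f (π n x) = ρ n (f x) := by
  refine DFunLike.congr_fun (f := f.comp (π n)) (g := (ρ n).comp f)
    (eq_of_eq_on_deg h fun k y hy => ?_) x
  change f (π n y) = ρ n (f y)
  by_cases hk : k = n
  · subst hk
    rw [hsame _ _ hy, hsame' _ _ (hf _ _ hy)]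
  · rw [hdiff _ _ _ hy hk, hdiff' _ _ _ (hf _ _ hy) hk, map_zero]

/-- The degree zero part of a linear map between graded modules. -/
theorem exists_degreeZeroPart [GradedRing ℬ] {M N : GrMod ℬ} (f : M.carrier →ₗ[B] N.carrier) :
    ∃ g : M.carrier →ₗ[B] N.carrier, IsHomogeneousMap g ∧
      ∀ (L : GrMod ℬ) (a : N.carrier →ₗ[B] L.carrier), IsHomogeneousMap a →
        IsHomogeneousMap (a ∘ₗ f : M.carrier →ₗ[B] L.carrier) → a ∘ₗ g = a ∘ₗ f := by
  classical
  obtain ⟨π, hmem, hsame, hdiff, hsum, hfin⟩ := exists_proj M.deg M.isGraded.isInternal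
  obtain ⟨ρ, hmem', hsame', hdiff', -, -⟩ := exists_proj N.deg N.isGraded.isInternal
  choose s hs using hfin
  -- This is the sum of all `ρ n ∘ f ∘ π n`, which is finite at each `x`. Enlarging the index set
  -- does not change it, so sums at different points can be compared.
  let g₀ : M.carrier → N.carrier := fun x => ∑ n ∈ s x, ρ n (f (π n x))
  have hg₀ : ∀ x (t : Finset ℕ), s x ⊆ t → g₀ x = ∑ n ∈ t, ρ n (f (π n x)) := by
    intro x t ht
    refine Finset.sum_subset ht fun n _ hn => ?_
    rw [hs x n hn, map_zero, map_zero]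
  have hadd : ∀ x y, g₀ (x + y) = g₀ x + g₀ y := by
    intro x y
    rw [hg₀ (x + y) (s (x + y) ∪ (s x ∪ s y)) Finset.subset_union_left,
      hg₀ x (s (x + y) ∪ (s x ∪ s y)) (by intro k hk; simp [hk]),
      hg₀ y (s (x + y) ∪ (s x ∪ s y)) (by intro k hk; simp [hk]), ← Finset.sum_add_distrib]
    simp only [map_add]
  let g₁ : M.carrier →+ N.carrier := AddMonoidHom.mk' g₀ hadd
  have hdeg : ∀ n x, x ∈ M.deg n → g₁ x = ρ n (f x) := by
    intro n x hx
    change g₀ x = _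
    rw [hg₀ x (s x ∪ {n}) Finset.subset_union_left, Finset.sum_eq_single n]
    · rw [hsame _ _ hx]
    · intro k _ hk
      rw [hdiff _ _ _ hx hk.symm, map_zero, map_zero]
    · intro hn
      simp at hn
  have hsmul : ∀ (b : B) x, g₁ (b • x) = b • g₁ x := by
    -- For `b` of degree `a`, multiplication by `b` carries the component of degree `n` to that of
    -- degree `a + n`. The general case follows by additivity in `x`, then in `b`.
    have key : ∀ (a n : ℕ) (b : B) (x : M.carrier), b ∈ ℬ a → x ∈ M.deg n →
        g₁ (b • x) = b • g₁ x := by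
      intro a n b x hb hx
      rw [hdeg _ _ (M.isGraded.smul_mem hb hx), hdeg _ _ hx, map_smul]
      refine DFunLike.congr_fun
        (f := (ρ (a + n)).comp (DistribSMul.toAddMonoidHom N.carrier b))
        (g := (DistribSMul.toAddMonoidHom N.carrier b).comp (ρ n))
        (eq_of_eq_on_deg N.isGraded.isInternal fun k y hy => ?_) (f x)
      change ρ (a + n) (b • y) = b • ρ n y
      by_cases hk : k = n
      · subst hk
        rw [hsame' _ _ hy, hsame' _ _ (N.isGraded.smul_mem hb hy)]
      · rw [hdiff' _ _ _ hy hk, hdiff' _ _ _ (N.isGraded.smul_mem hb hy) (by omega), smul_zero]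
    intro b x
    refine DFunLike.congr_fun
      (f := g₁.comp ((AddMonoidHom.flip (smulAddHom B M.carrier)) x))
      (g := (AddMonoidHom.flip (smulAddHom B N.carrier)) (g₁ x))
      (eq_of_eq_on_deg (DirectSum.Decomposition.isInternal ℬ) fun a b hb => ?_) b
    exact DFunLike.congr_fun
      (f := g₁.comp (DistribSMul.toAddMonoidHom M.carrier b))
      (g := (DistribSMul.toAddMonoidHom N.carrier b).comp g₁)
      (eq_of_eq_on_deg M.isGraded.isInternal fun n x hx => key a n b x hb hx) x
  refine ⟨{ g₁ with map_smul' := hsmul }, fun n x hx => ?_, fun L a ha haf => ?_⟩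
  · change g₁ x ∈ _
    rw [hdeg n x hx]
    exact hmem' _ _
  -- On `x` of degree `n`, the homogeneous map `a` commutes with projections, and `a (f x)` already
  -- lies in degree `n`.
  · obtain ⟨σ, -, hsame'', hdiff'', -, -⟩ := exists_proj L.deg L.isGraded.isInternal
    apply LinearMap.toAddMonoidHom_injective
    refine eq_of_eq_on_deg M.isGraded.isInternal fun n x hx => ?_
    change a (g₁ x) = a (f x)
    rw [hdeg n x hx]
    have := map_proj N.isGraded.isInternal a.toAddMonoidHom (fun n x hx => ha n x hx)
      hsame' hdiff' hsame'' hdiff'' n (f x)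
    exact this.trans (hsame'' _ _ (haf n x hx))

/-- Homogeneous maps from a graded projective module can be lifted. -/
theorem exists_homogeneous_lift [GradedRing ℬ] {P M N : GrMod ℬ}
    [Module.Projective B P.carrier] {a : M.carrier →ₗ[B] N.carrier} (ha : IsHomogeneousMap a)
    {f : P.carrier →ₗ[B] N.carrier} (hf : IsHomogeneousMap f) (h : ∀ x, ∃ y, a y = f x) :
    ∃ g : P.carrier →ₗ[B] M.carrier, IsHomogeneousMap g ∧ ∀ x, a (g x) = f x := by
  obtain ⟨g, hg⟩ := Module.projective_lifting_property a.rangeRestrict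
    (f.codRestrict (LinearMap.range a) h) a.surjective_rangeRestrict
  have hg' : a ∘ₗ g = f := by
    ext x
    exact congrArg Subtype.val (LinearMap.congr_fun hg x)
  -- The lift given by projectivity need not be homogeneous. Its degree zero part is, and it is
  -- still a lift because `a` and `f` are homogeneous.
  obtain ⟨g', hhom, hg''⟩ := exists_degreeZeroPart (M := P) (N := M) g
  refine ⟨g', hhom, fun x => ?_⟩
  have := hg'' N a ha (by rw [hg']; exact hf)
  rw [hg'] at this
  exact LinearMap.congr_fun this x

/-- A recursive choice with an invariant `S`. For chain maps and homotopies, `S` records that the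
next lifting problem is solvable. -/
theorem exists_seq {α : ℕ → Type*} (S : ∀ n, α n → Prop) (r : ∀ n, α n → α (n + 1) → Prop)
    (a₀ : α 0) (h₀ : S 0 a₀) (hs : ∀ n a, S n a → ∃ b, S (n + 1) b ∧ r n a b) :
    ∃ a : ∀ n, α n, a 0 = a₀ ∧ (∀ n, S n (a n)) ∧ ∀ n, r n (a n) (a (n + 1)) := by
  choose b hb hr using hs
  let c : ∀ n, {a : α n // S n a} :=
    fun n => Nat.rec ⟨a₀, h₀⟩ (fun n a => ⟨b n a.1 a.2, hb n a.1 a.2⟩) n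
  exact ⟨fun n => (c n).1, rfl, fun n => (c n).2, fun n => hr n (c n).1 (c n).2⟩

namespace GradedProjRes

variable [GradedRing ℬ] {N : GrMod ℬ} (P Q : GradedProjRes N)

/-- Existence half of the comparison theorem: lift the augmentation, then lift `f i ∘ d` step by
step, always homogeneously. -/
theorem exists_chainMap : ∃ f : ∀ i, (P.X i).carrier →ₗ[B] (Q.X i).carrier,
    (∀ i, IsHomogeneousMap (f i)) ∧ (∀ x, Q.aug (f 0 x) = P.aug x) ∧
      ∀ i x, Q.d i (f (i + 1) x) = f i (P.d i x) := by
  have := P.projective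
  obtain ⟨f₀, hf₀, hf₀'⟩ := exists_homogeneous_lift Q.aug_homogeneous P.aug_homogeneous
    (fun x => Q.aug_surjective (P.aug x))
  obtain ⟨f, h0, hS, hr⟩ := exists_seq
    (α := fun i => (P.X i).carrier →ₗ[B] (Q.X i).carrier)
    -- The second condition makes the next lift possible. It persists because `Q.d i` kills the next
    -- such composite, which by exactness lies in the range of `Q.d (i + 1)`.
    (fun i f => IsHomogeneousMap f ∧ ∀ x, ∃ y, Q.d i y = f (P.d i x))
    (fun i f g => ∀ x, Q.d i (g x) = f (P.d i x)) f₀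
    ⟨hf₀, fun x => (Q.exact_zero _).1 (by
      rw [hf₀']
      exact P.exact_zero.apply_apply_eq_zero x)⟩
    (fun i f ⟨hf, hf'⟩ => by
      obtain ⟨g, hg, hg'⟩ := exists_homogeneous_lift (Q.d_homogeneous i)
        (hf.comp (P.d_homogeneous i)) hf'
      refine ⟨g, ⟨hg, fun x => (Q.exact_succ i _).1 ?_⟩, hg'⟩
      rw [hg', LinearMap.comp_apply, (P.exact_succ i).apply_apply_eq_zero, map_zero])
  exact ⟨f, fun i => (hS i).1, by rw [h0]; exact hf₀', hr⟩

variable {P} in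
-- Uniqueness half of the comparison theorem: a chain endomorphism over the zero map is
-- null-homotopic. At each stage `u - s d` consists of cycles, since `d u = u d` and `d s d = u d`
-- (the remaining term contains `d d = 0`), so exactness and projectivity supply the next `s`.
theorem exists_homotopy {u : ∀ i, (P.X i).carrier →ₗ[B] (P.X i).carrier}
    (hu : ∀ i, IsHomogeneousMap (u i)) (haug : ∀ x, P.aug (u 0 x) = 0)
    (hd : ∀ i x, P.d i (u (i + 1) x) = u i (P.d i x)) :
    ∃ s : ∀ i, (P.X i).carrier →ₗ[B] (P.X (i + 1)).carrier, (∀ i, IsHomogeneousMap (s i)) ∧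
      (∀ x, P.d 0 (s 0 x) = u 0 x) ∧
        ∀ i x, P.d (i + 1) (s (i + 1) x) = u (i + 1) x - s i (P.d i x) := by
  have := P.projective
  obtain ⟨s₀, hs₀, hs₀'⟩ := exists_homogeneous_lift (P.d_homogeneous 0) (hu 0)
    (fun x => (P.exact_zero _).1 (haug x))
  obtain ⟨s, h0, hS, hr⟩ := exists_seq
    (α := fun i => (P.X i).carrier →ₗ[B] (P.X (i + 1)).carrier)
    (fun i s => IsHomogeneousMap s ∧
      ∀ x, ∃ y, P.d (i + 1) y = (u (i + 1) - s ∘ₗ P.d i) x)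
    (fun i s t => ∀ x, P.d (i + 1) (t x) = (u (i + 1) - s ∘ₗ P.d i) x) s₀
    ⟨hs₀, fun x => (P.exact_succ 0 _).1 (by
      rw [LinearMap.sub_apply, map_sub, hd, LinearMap.comp_apply, hs₀', sub_self])⟩
    (fun i s ⟨hs, hs'⟩ => by
      obtain ⟨t, ht, ht'⟩ := exists_homogeneous_lift (P.d_homogeneous (i + 1))
        ((hu (i + 1)).sub (hs.comp (P.d_homogeneous i))) hs'
      refine ⟨t, ⟨ht, fun x => (P.exact_succ (i + 1) _).1 ?_⟩, ht'⟩
      rw [LinearMap.sub_apply, map_sub, hd, LinearMap.comp_apply, ht', LinearMap.sub_apply,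
        LinearMap.comp_apply, (P.exact_succ i).apply_apply_eq_zero, map_zero, sub_zero, sub_self])
  exact ⟨s, fun i => (hS i).1, by rw [h0]; exact hs₀', hr⟩

end GradedProjRes

/-! ### Independence of the vanishing of graded homology from the resolution. -/

section Homology

variable {M : Type u} [AddCommGroup M] [Module Bᵐᵒᵖ M] (degM : ℕ → AddSubgroup M)

theorem btmapRight_mem_tensorDeg {X Y : GrMod ℬ} {f : X.carrier →ₗ[B] Y.carrier}
    (hf : IsHomogeneousMap f) {j : ℕ} {x : BTensor B M X.carrier} (hx : x ∈ tensorDeg degM X j) :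
    btmapRight M f x ∈ tensorDeg degM Y j := by
  induction hx using Submodule.span_induction with
  | mem x hx =>
    obtain ⟨a, b, m, n, hab, hm, hn, rfl⟩ := hx
    exact Submodule.subset_span ⟨a, b, m, f n, hab, hm, hf _ _ hn, rfl⟩
  | zero => rw [map_zero]; exact Submodule.zero_mem _
  | add x y _ _ hx hy => rw [map_add]; exact Submodule.add_mem _ hx hy
  | smul k x _ hx => rw [map_zsmul]; exact Submodule.smul_mem _ k hx

namespace GradedProjRes

variable {N : GrMod ℬ} (P : GradedProjRes N)

theorem subsingleton_homology_iff (i j : ℕ) : Subsingleton (P.homology degM i j) ↔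
    ∀ x ∈ P.cycles degM i j, ∃ y ∈ tensorDeg degM (P.X (i + 1)) j,
      btmapRight M (P.d i) y = x := by
  rw [Submodule.Quotient.subsingleton_iff, Submodule.submoduleOf, Submodule.comap_subtype_eq_top]
  exact Iff.rfl

variable {P} in
-- With `f : P → Q` and `g : Q → P` over the identity and `s` a homotopy from `id` to `g f`, a cycle
-- `x` satisfies `x = g (f x) - d (s x)`. If `f x = d y`, then `x` is the boundary of `g y - s x`.
-- All the maps are homogeneous, so internal degrees are respected.
theorem subsingleton_homology_of [GradedRing ℬ] (Q : GradedProjRes N) {i j : ℕ}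
    (h : Subsingleton (Q.homology degM i j)) : Subsingleton (P.homology degM i j) := by
  rw [subsingleton_homology_iff] at h ⊢
  obtain ⟨f, hf, hfaug, hfd⟩ := exists_chainMap P Q
  obtain ⟨g, hg, hgaug, hgd⟩ := exists_chainMap Q P
  obtain ⟨s, hs, hs0, hsd⟩ := exists_homotopy (P := P)
    (u := fun i => g i ∘ₗ f i - LinearMap.id)
    (fun i => ((hg i).comp (hf i)).sub (IsHomogeneousMap.id _))
    (fun x => by
      rw [LinearMap.sub_apply, map_sub, LinearMap.comp_apply, hgaug, hfaug, LinearMap.id_apply,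
        sub_self])
    (fun i x => by
      simp only [LinearMap.sub_apply, map_sub, LinearMap.comp_apply, hgd, hfd, LinearMap.id_apply])
  have hfd' : ∀ i x, btmapRight M (Q.d i) (btmapRight M (f (i + 1)) x) =
      btmapRight M (f i) (btmapRight M (P.d i) x) := by
    intro i x
    rw [← btmapRight_comp, ← btmapRight_comp]
    exact DFunLike.congr_fun (congrArg (btmapRight M) (LinearMap.ext (hfd i))) x
  have hgd' : ∀ i x, btmapRight M (P.d i) (btmapRight M (g (i + 1)) x) =
      btmapRight M (g i) (btmapRight M (Q.d i) x) := by
    intro i x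
    rw [← btmapRight_comp, ← btmapRight_comp]
    exact DFunLike.congr_fun (congrArg (btmapRight M) (LinearMap.ext (hgd i))) x
  have key : ∀ x ∈ P.cycles degM i j, x ∈ tensorDeg degM (P.X i) j ∧
      btmapRight M (f i) x ∈ Q.cycles degM i j ∧
      btmapRight M (P.d i) (btmapRight M (s i) x) + x =
        btmapRight M (g i) (btmapRight M (f i) x) := by
    intro x hx
    cases i with
    | zero =>
      refine ⟨hx, btmapRight_mem_tensorDeg degM (hf 0) hx, ?_⟩
      conv_lhs => rw [← btmapRight_id x, ← btmapRight_comp, ← btmapRight_comp, ← btmapRight_add]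
      rw [← btmapRight_comp]
      refine DFunLike.congr_fun (congrArg (btmapRight M) (LinearMap.ext fun y => ?_)) x
      simp [hs0]
    | succ i =>
      have hx0 : btmapRight M (P.d i) x = 0 := hx.2
      refine ⟨hx.1, ⟨btmapRight_mem_tensorDeg degM (hf _) hx.1, ?_⟩, ?_⟩
      · change btmapRight M (Q.d i) _ = 0
        rw [hfd', hx0, map_zero]
      · have h1 : P.d (i + 1) ∘ₗ s (i + 1) + (s i ∘ₗ P.d i + LinearMap.id) =
            g (i + 1) ∘ₗ f (i + 1) := by
          ext y
          simp only [LinearMap.add_apply, LinearMap.comp_apply, hsd, LinearMap.sub_apply,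
            LinearMap.id_apply]
          abel
        rw [← btmapRight_comp, ← btmapRight_comp, ← h1, btmapRight_add, btmapRight_add,
          btmapRight_id, btmapRight_comp (s i), hx0, map_zero, zero_add]
  intro x hx
  obtain ⟨hx1, hx2, hx3⟩ := key x hx
  obtain ⟨y, hy, hyx⟩ := h _ hx2
  refine ⟨btmapRight M (g (i + 1)) y - btmapRight M (s i) x, Submodule.sub_mem _
    (btmapRight_mem_tensorDeg degM (hg _) hy) (btmapRight_mem_tensorDeg degM (hs i) hx1), ?_⟩
  rw [map_sub, hgd', hyx, ← hx3, add_sub_cancel_left]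

end GradedProjRes

end Homology

end Comparison

/-! ### Matrices over noncommutative rings -/

section Matrices

variable {K S T : Type u} [Ring K] [Ring S] [Ring T] {I J L : Type u}

/-- The map of free modules obtained by applying a ring homomorphism to the entries of a matrix. -/
def mapMatrix (φ : K →+* S) (d : (I →₀ K) →ₗ[K] (J →₀ K)) : (I →₀ S) →ₗ[S] (J →₀ S) :=
  Finsupp.linearCombination S fun i =>
    (Finsupp.mapRange φ (map_zero φ) (d (Finsupp.single i 1)) : J →₀ S)

theorem mapMatrix_single (φ : K →+* S) (d : (I →₀ K) →ₗ[K] (J →₀ K)) (i : I) (s : S) :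
    mapMatrix φ d (Finsupp.single i s) =
      s • Finsupp.mapRange φ (map_zero φ) (d (Finsupp.single i 1)) := by
  rw [mapMatrix, Finsupp.linearCombination_single]

theorem mapRange_smul (φ : K →+* S) (k : K) (f : I →₀ K) :
    Finsupp.mapRange φ (map_zero φ) (k • f) = φ k • Finsupp.mapRange φ (map_zero φ) f := by
  ext i
  simp

theorem mapMatrix_mapRange (φ : K →+* S) (d : (I →₀ K) →ₗ[K] (J →₀ K)) (f : I →₀ K) :
    mapMatrix φ d (Finsupp.mapRange φ (map_zero φ) f) =
      Finsupp.mapRange φ (map_zero φ) (d f) := by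
  induction f using Finsupp.induction_linear with
  | zero => simp
  | add f g hf hg =>
    rw [map_add d, Finsupp.mapRange_add (map_add φ), Finsupp.mapRange_add (map_add φ), map_add,
      hf, hg]
  | single i k =>
    rw [Finsupp.mapRange_single, mapMatrix_single, ← mapRange_smul, ← map_smul,
      Finsupp.smul_single, smul_eq_mul, mul_one]

theorem mapMatrix_smul_mapRange (φ : K →+* S) (d : (I →₀ K) →ₗ[K] (J →₀ K)) (s : S)
    (f : I →₀ K) : mapMatrix φ d (s • Finsupp.mapRange φ (map_zero φ) f) =
      s • Finsupp.mapRange φ (map_zero φ) (d f) := by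
  rw [map_smul, mapMatrix_mapRange]

/-- This lets reductions of the same matrix along two composites of ring homomorphisms be compared.
-/
theorem mapMatrix_mapMatrix (ψ : S →+* T) (φ : K →+* S) (d : (I →₀ K) →ₗ[K] (J →₀ K)) :
    mapMatrix ψ (mapMatrix φ d) = mapMatrix (ψ.comp φ) d := by
  refine Finsupp.lhom_ext' fun i => LinearMap.ext_ring ?_
  rw [LinearMap.comp_apply, LinearMap.comp_apply, Finsupp.lsingle_apply, mapMatrix_single,
    mapMatrix_single, mapMatrix_single, one_smul, one_smul, one_smul]
  ext j
  simp

/-- Setting to zero all coordinates outside a set of indices. -/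
def lfilter (p : I → Prop) [DecidablePred p] : (I →₀ K) →ₗ[K] (I →₀ K) where
  toFun := fun f => f.filter p
  map_add' := fun _ _ => Finsupp.filter_add
  map_smul' := fun _ _ => Finsupp.filter_smul

theorem lfilter_apply (p : I → Prop) [DecidablePred p] (f : I →₀ K) :
    lfilter p f = f.filter p := rfl

end Matrices

/-! ### Graded free resolutions -/

section FreeResolutions

variable {B : Type u} [Ring B] {ℬ : ℕ → AddSubgroup B}

/-- There is one generator for each homogeneous element. Explicit homogeneous bases make the
differentials matrices, to which ring homomorphisms can be applied entrywise. -/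
theorem exists_free_cover (N : GrMod ℬ) : ∃ (I : Type u) (δ : I → ℕ)
    (f : (I →₀ B) →ₗ[B] N.carrier), (∀ i, f (Finsupp.single i 1) ∈ N.deg (δ i)) ∧
      Function.Surjective f := by
  refine ⟨Σ n, N.deg n, fun i => i.1, Finsupp.linearCombination B fun i => (i.2 : N.carrier),
    fun i => ?_, fun x => ?_⟩
  · rw [Finsupp.linearCombination_single, one_smul]
    exact i.2.2
  · obtain ⟨π, hmem, -, -, hsum, -⟩ := exists_proj N.deg N.isGraded.isInternal
    obtain ⟨s, hs⟩ := hsum x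
    refine ⟨∑ n ∈ s, Finsupp.single ⟨n, ⟨π n x, hmem n x⟩⟩ 1, ?_⟩
    rw [map_sum]
    simpa using hs

variable [GradedRing ℬ]

variable (ℬ) in
/-- The graded free module on generators `i` of degree `δ i`. -/
abbrev freeGrMod {I : Type u} (δ : I → ℕ) : GrMod ℬ := ⟨I →₀ B, freeDeg ℬ δ, freeDeg_isGraded ℬ δ⟩

theorem single_one_mem_freeDeg {I : Type u} (δ : I → ℕ) (i : I) :
    Finsupp.single i 1 ∈ freeDeg ℬ δ (δ i) := by
  classical
  intro k
  rw [Finsupp.single_apply]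
  split_ifs with h
  · subst h
    simpa [shiftDeg] using SetLike.GradedOne.one_mem
  · exact AddSubgroup.zero_mem _

theorem isHomogeneousMap_of_single {I : Type u} {δ : I → ℕ} {N : GrMod ℬ}
    {f : (I →₀ B) →ₗ[B] N.carrier} (hf : ∀ i, f (Finsupp.single i 1) ∈ N.deg (δ i)) :
    IsHomogeneousMap (M := freeGrMod ℬ δ) f := by
  intro n (x : I →₀ B) (hx : x ∈ freeDeg ℬ δ n)
  change f x ∈ _
  rw [← Finsupp.sum_single x, map_finsuppSum]
  refine AddSubgroup.sum_mem _ fun i _ => ?_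
  have := hx i
  change f (Finsupp.single i (x i)) ∈ _
  rw [← mul_one (x i), ← smul_eq_mul, ← Finsupp.smul_single, map_smul]
  by_cases h : δ i ≤ n
  · simp only [shiftDeg, h, if_true] at this
    have h2 := N.isGraded.smul_mem this (hf i)
    rwa [Nat.sub_add_cancel h] at h2
  · simp only [shiftDeg, h, if_false, AddSubgroup.mem_bot] at this
    rw [this, zero_smul]
    exact AddSubgroup.zero_mem _

/-- A resolution of a graded module by graded free modules with homogeneous bases. -/
structure GradedFreeRes (N : GrMod ℬ) where
  I : ℕ → Type u
  δ : ∀ i, I i → ℕ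
  d : ∀ i, (I (i + 1) →₀ B) →ₗ[B] (I i →₀ B)
  d_mem : ∀ i k, d i (Finsupp.single k 1) ∈ freeDeg ℬ (δ i) (δ (i + 1) k)
  aug : (I 0 →₀ B) →ₗ[B] N.carrier
  aug_mem : ∀ k, aug (Finsupp.single k 1) ∈ N.deg (δ 0 k)
  aug_surjective : Function.Surjective aug
  exact_zero : Function.Exact (d 0) aug
  exact_succ : ∀ i, Function.Exact (d (i + 1)) (d i)

/-- A graded free resolution is a graded projective resolution. -/
abbrev GradedFreeRes.toGradedProjRes {N : GrMod ℬ} (F : GradedFreeRes N) : GradedProjRes N where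
  X := fun i => freeGrMod ℬ (F.δ i)
  projective := fun i => inferInstanceAs (Module.Projective B (F.I i →₀ B))
  d := F.d
  d_homogeneous := fun i =>
    isHomogeneousMap_of_single (N := freeGrMod ℬ (F.δ i)) (F.d_mem i)
  aug := F.aug
  aug_homogeneous := isHomogeneousMap_of_single F.aug_mem
  aug_surjective := F.aug_surjective
  exact_zero := F.exact_zero
  exact_succ := F.exact_succ

theorem nonempty_gradedFreeRes (N : GrMod ℬ) : Nonempty (GradedFreeRes N) := by
  choose I δ f hmem hsurj using fun M : GrMod ℬ => exists_free_cover M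
  have hhom := fun M : GrMod ℬ => isHomogeneousMap_of_single (hmem M)
  -- The iterated syzygies: `Z 0 = N`, and `Z (i + 1)` is the kernel of the free cover of `Z i`.
  let Z : ℕ → GrMod ℬ := fun i =>
    Nat.rec (motive := fun _ => GrMod ℬ) N
      (fun _ M => GrMod.ker (M := freeGrMod ℬ (δ M)) (f M) (hhom M)) i
  refine ⟨{
    I := fun i => I (Z i)
    δ := fun i => δ (Z i)
    d := fun i => (LinearMap.ker (f (Z i))).subtype.comp
      (f (Z (i + 1)) : (I (Z (i + 1)) →₀ B) →ₗ[B] LinearMap.ker (f (Z i)))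
    d_mem := fun i k => hmem (Z (i + 1)) k
    aug := f N
    aug_mem := hmem N
    aug_surjective := hsurj N
    exact_zero := ?_
    exact_succ := ?_ }⟩
  · intro x
    constructor
    · intro hx
      obtain ⟨y, hy⟩ := hsurj (Z 1) ⟨x, hx⟩
      exact ⟨y, congrArg Subtype.val hy⟩
    · rintro ⟨y, rfl⟩
      exact (f (Z 1) y).2
  · intro i x
    constructor
    · intro hx
      have hx' : f (Z (i + 1)) x = 0 := Subtype.ext hx
      obtain ⟨y, hy⟩ := hsurj (Z (i + 2)) ⟨x, hx'⟩
      exact ⟨y, congrArg Subtype.val hy⟩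
    · rintro ⟨y, rfl⟩
      have h : f (Z (i + 1)) (f (Z (i + 2)) y).1 = 0 := (f (Z (i + 2)) y).2
      exact congrArg Subtype.val h

end FreeResolutions

/-! ### Tor in terms of matrices -/

section MatrixTor

variable {R B : Type u} [Ring R] [Ring B]

/-- The isomorphism `R ⊗_B B ≅ R` for a ring homomorphism `B → R`. -/
def rightViaEquiv (ε : B →+* R) : BTensor B (RightVia ε) B ≃+ R :=
  BTensor.selfEquiv B (RightVia ε)

/-- The isomorphism `R ⊗_B B^(I) ≅ R^(I)` for a ring homomorphism `B → R`. -/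
def rightViaFinsuppEquiv (ε : B →+* R) (I : Type u) :
    BTensor B (RightVia ε) (I →₀ B) ≃+ (I →₀ R) :=
  BTensor.finsuppEquiv I (rightViaEquiv ε)

theorem rightViaFinsuppEquiv_btmul (ε : B →+* R) {I : Type u} (r : R) (f : I →₀ B) :
    rightViaFinsuppEquiv ε I (btmul B (show RightVia ε from r) f) =
      r • Finsupp.mapRange ε (map_zero ε) f := by
  ext i
  rw [Finsupp.smul_apply, Finsupp.mapRange_apply]
  rfl

/-- This turns the complex computing Tor into a complex of matrices over `R`: tensoring along `ε`
amounts to reducing entries by `ε`. -/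
theorem rightViaFinsuppEquiv_btmapRight (ε : B →+* R) {I J : Type u}
    (d : (I →₀ B) →ₗ[B] (J →₀ B)) (x : BTensor B (RightVia ε) (I →₀ B)) :
    rightViaFinsuppEquiv ε J (btmapRight (RightVia ε) d x) =
      mapMatrix ε d (rightViaFinsuppEquiv ε I x) :=
  DFunLike.congr_fun
    (f := (rightViaFinsuppEquiv ε J).toAddMonoidHom.comp (btmapRight (RightVia ε) d))
    (g := (mapMatrix ε d).toAddMonoidHom.comp (rightViaFinsuppEquiv ε I).toAddMonoidHom)
    (BTensor.hom_ext fun r f => by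
      change rightViaFinsuppEquiv ε J (btmul B r (d f)) =
        mapMatrix ε d (rightViaFinsuppEquiv ε I (btmul B r f))
      have h1 := rightViaFinsuppEquiv_btmul ε r (d f)
      have h2 := rightViaFinsuppEquiv_btmul ε r f
      exact h1.trans ((mapMatrix_smul_mapRange ε d r f).symm.trans (congrArg _ h2.symm))) x

theorem rightViaFinsuppEquiv_symm_single (ε : B →+* R) {I : Type u} (i : I) (r : R) :
    (rightViaFinsuppEquiv ε I).symm (Finsupp.single i r) =
      btmul B (show RightVia ε from r) (Finsupp.single i 1) := by
  rw [AddEquiv.symm_apply_eq, rightViaFinsuppEquiv_btmul, Finsupp.mapRange_single, map_one,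
    Finsupp.smul_single, smul_eq_mul, mul_one]

variable {η : R →+* B} {ℬ : ℕ → AddSubgroup B} [GradedRing ℬ] (h : IsDegreeZero η ℬ)

/-- Such a `b` is either zero or homogeneous of degree `n - d > 0`. Hence the augmentation keeps
only the matrix entries between generators of equal degree. -/
theorem IsDegreeZero.augmentation_of_shiftDeg {d n : ℕ} (hdn : d ≠ n) {b : B}
    (hb : b ∈ shiftDeg ℬ d n) : h.augmentation b = 0 := by
  by_cases hd : d ≤ n
  · simp only [shiftDeg, hd, if_true] at hb
    exact h.augmentation_of_pos (by omega) hb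
  · simp only [shiftDeg, hd, if_false, AddSubgroup.mem_bot] at hb
    rw [hb, map_zero]

/-- Since `R` sits in degree zero and the augmentation kills positive degrees, the internal degree
of `R ⊗_B B^(I) ≅ R^(I)` is read off from the degrees of the generators. -/
theorem mem_tensorDeg_free_iff {I : Type u} (δ : I → ℕ) (j : ℕ)
    (x : BTensor B (RightVia h.augmentation) (I →₀ B)) :
    x ∈ tensorDeg (degZero (RightVia h.augmentation)) (freeGrMod ℬ δ) j ↔
      ∀ k, δ k ≠ j → rightViaFinsuppEquiv h.augmentation I x k = 0 := by
  constructor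
  · intro hx
    induction hx using Submodule.span_induction with
    | mem x hx =>
      obtain ⟨a, b, m, n, hab, hm, hn, rfl⟩ := hx
      intro k hk
      change (show R from m) * h.augmentation ((show I →₀ B from n) k) = 0
      by_cases ha : a = 0
      · rw [h.augmentation_of_shiftDeg (by omega) (hn k), mul_zero]
      · simp only [degZero, ha, if_false, AddSubgroup.mem_bot] at hm
        rw [hm]
        exact zero_mul _
    | zero => intro k _; rw [map_zero]; rfl
    | add x y _ _ hx hy =>
      intro k hk
      rw [map_add, Finsupp.add_apply, hx k hk, hy k hk, add_zero]
    | smul n x _ hx =>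
      intro k hk
      rw [map_zsmul, Finsupp.smul_apply, hx k hk, smul_zero]
  · intro hx
    obtain ⟨g, rfl⟩ := (rightViaFinsuppEquiv h.augmentation I).symm.surjective x
    rw [AddEquiv.apply_symm_apply] at hx
    rw [← Finsupp.sum_single g, map_finsuppSum]
    refine Submodule.sum_mem _ fun k hk => ?_
    beta_reduce
    rw [rightViaFinsuppEquiv_symm_single]
    have hkj : δ k = j := by
      by_contra hkj
      exact Finsupp.mem_support_iff.1 hk (hx k hkj)
    refine Submodule.subset_span ⟨0, j, _, _, zero_add j, ?_, ?_, rfl⟩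
    · rw [degZero, if_pos rfl]
      trivial
    · rw [← hkj]
      exact single_one_mem_freeDeg δ k

namespace GradedFreeRes

variable {h} {N : GrMod ℬ} (F : GradedFreeRes N)

/-- Entries between generators of different degrees reduce to zero, so the reduced complex splits as
a direct sum over generator degrees. -/
theorem mapMatrix_filter (i j : ℕ) (f : F.I (i + 1) →₀ R) :
    mapMatrix h.augmentation (F.d i) (f.filter fun k => F.δ (i + 1) k = j) =
      (mapMatrix h.augmentation (F.d i) f).filter fun k => F.δ i k = j := by
  have key : ∀ k, mapMatrix h.augmentation (F.d i)
        ((Finsupp.single k 1).filter fun k => F.δ (i + 1) k = j) =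
      (mapMatrix h.augmentation (F.d i) (Finsupp.single k 1)).filter fun k => F.δ i k = j := by
    intro k
    rw [mapMatrix_single, one_smul]
    ext l
    rw [Finsupp.filter_apply, Finsupp.mapRange_apply]
    by_cases hkl : F.δ i l = F.δ (i + 1) k
    · by_cases hl : F.δ i l = j
      · rw [Finsupp.filter_single_of_pos (fun k => F.δ (i + 1) k = j) (hkl ▸ hl),
          mapMatrix_single, one_smul, if_pos hl, Finsupp.mapRange_apply]
      · rw [Finsupp.filter_single_of_neg (fun k => F.δ (i + 1) k = j) (hkl ▸ hl), map_zero,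
          if_neg hl, Finsupp.zero_apply]
    · have h0 := h.augmentation_of_shiftDeg hkl (F.d_mem i k l)
      rw [h0, ite_self]
      by_cases hk : F.δ (i + 1) k = j
      · rw [Finsupp.filter_single_of_pos (fun k => F.δ (i + 1) k = j) hk, mapMatrix_single,
          one_smul, Finsupp.mapRange_apply, h0]
      · rw [Finsupp.filter_single_of_neg (fun k => F.δ (i + 1) k = j) hk, map_zero,
          Finsupp.zero_apply]
  refine LinearMap.congr_fun
    (f := mapMatrix h.augmentation (F.d i) ∘ₗ lfilter fun k => F.δ (i + 1) k = j)
    (g := (lfilter fun k => F.δ i k = j) ∘ₗ mapMatrix h.augmentation (F.d i)) ?_ f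
  exact Finsupp.lhom_ext' fun k => LinearMap.ext_ring (key k)

/-- A preimage of an element concentrated in degree `j` can be cut down to its coordinates of degree
`j`, so no degree condition on the preimage is needed. -/
theorem exists_boundary_iff (i j : ℕ)
    {x : BTensor B (RightVia h.augmentation) (F.I i →₀ B)}
    (hx : ∀ k, F.δ i k ≠ j → rightViaFinsuppEquiv h.augmentation _ x k = 0) :
    (∃ y ∈ tensorDeg (degZero (RightVia h.augmentation)) (freeGrMod ℬ (F.δ (i + 1))) j,
      btmapRight (RightVia h.augmentation) (F.d i) y = x) ↔
    ∃ f, mapMatrix h.augmentation (F.d i) f = rightViaFinsuppEquiv h.augmentation _ x := by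
  constructor
  · rintro ⟨y, -, rfl⟩
    exact ⟨_, (rightViaFinsuppEquiv_btmapRight _ _ _).symm⟩
  · rintro ⟨f, hf⟩
    refine ⟨(rightViaFinsuppEquiv h.augmentation _).symm (f.filter fun k => F.δ (i + 1) k = j),
      (mem_tensorDeg_free_iff h _ _ _).2 fun k hk => ?_,
      (rightViaFinsuppEquiv h.augmentation _).injective ?_⟩
    · rw [AddEquiv.apply_symm_apply, Finsupp.filter_apply_neg (fun k => F.δ (i + 1) k = j) _ hk]
    · rw [rightViaFinsuppEquiv_btmapRight, AddEquiv.apply_symm_apply, mapMatrix_filter, hf,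
        Finsupp.filter_eq_self_iff]
      intro k hk
      by_contra hkj
      exact hk (hx k hkj)

variable (h)

/-- Here and in the next lemma, being concentrated in degree `j` is phrased as the vanishing of the
linear map that keeps the coordinates of degree `≠ j`. Vanishing of Tor thus becomes exactness at
kernels of matrices, a form that flat base change preserves. -/
theorem subsingleton_homology_zero_iff (j : ℕ) :
    Subsingleton (F.toGradedProjRes.homology (degZero (RightVia h.augmentation)) 0 j) ↔
      ∀ g : F.I 0 →₀ R, (g.filter fun k => F.δ 0 k ≠ j) = 0 →
        ∃ f, mapMatrix h.augmentation (F.d 0) f = g := by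
  rw [GradedProjRes.subsingleton_homology_iff]
  constructor
  · intro H g hg
    obtain ⟨x, rfl⟩ := (rightViaFinsuppEquiv h.augmentation _).surjective g
    rw [Finsupp.filter_eq_zero_iff] at hg
    exact (F.exists_boundary_iff 0 j hg).1 (H x ((mem_tensorDeg_free_iff h _ _ _).2 hg))
  · intro H x hx
    have hx' := (mem_tensorDeg_free_iff h _ _ _).1 hx
    exact (F.exists_boundary_iff 0 j hx').2 (H _ ((Finsupp.filter_eq_zero_iff _ _).2 hx'))

theorem subsingleton_homology_succ_iff (i j : ℕ) :
    Subsingleton (F.toGradedProjRes.homology (degZero (RightVia h.augmentation)) (i + 1) j) ↔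
      ∀ g : F.I (i + 1) →₀ R, mapMatrix h.augmentation (F.d i) g = 0 →
        (g.filter fun k => F.δ (i + 1) k ≠ j) = 0 →
          ∃ f, mapMatrix h.augmentation (F.d (i + 1)) f = g := by
  rw [GradedProjRes.subsingleton_homology_iff]
  constructor
  · intro H g hg0 hg
    obtain ⟨x, rfl⟩ := (rightViaFinsuppEquiv h.augmentation _).surjective g
    rw [Finsupp.filter_eq_zero_iff] at hg
    refine (F.exists_boundary_iff (i + 1) j hg).1
      (H x ⟨(mem_tensorDeg_free_iff h _ _ _).2 hg, ?_⟩)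
    apply (rightViaFinsuppEquiv h.augmentation _).injective
    rw [map_zero]
    exact (rightViaFinsuppEquiv_btmapRight _ _ _).trans hg0
  · intro H x hx
    have hx' := (mem_tensorDeg_free_iff h _ _ _).1 hx.1
    refine (F.exists_boundary_iff (i + 1) j hx').2 (H _ ?_ ((Finsupp.filter_eq_zero_iff _ _).2 hx'))
    have hx0 : btmapRight (RightVia h.augmentation) (F.d i) x = 0 := hx.2
    rw [← rightViaFinsuppEquiv_btmapRight, hx0, map_zero]

end GradedFreeRes

end MatrixTor

/-- Exactness after tensoring with a flat module, transported along isomorphisms. -/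
theorem IsRightFlat.function_exact {K M N N' N'' : Type u} [Ring K] [AddCommGroup M]
    [Module Kᵐᵒᵖ M] [AddCommGroup N] [Module K N] [AddCommGroup N'] [Module K N']
    [AddCommGroup N''] [Module K N''] (hM : IsRightFlat K M) {f : N →ₗ[K] N'} {g : N' →ₗ[K] N''}
    (hfg : Function.Exact f g) {X Y Z : Type*} [AddCommGroup X] [AddCommGroup Y] [AddCommGroup Z]
    {f' : X →+ Y} {g' : Y →+ Z} (τX : BTensor K M N ≃+ X) (τY : BTensor K M N' ≃+ Y)
    (τZ : BTensor K M N'' ≃+ Z) (hf' : ∀ x, τY (btmapRight M f x) = f' (τX x))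
    (hg' : ∀ y, τZ (btmapRight M g y) = g' (τY y)) : Function.Exact f' g' := by
  intro y
  obtain ⟨y, rfl⟩ := τY.surjective y
  rw [← hg', map_eq_zero_iff _ τZ.injective]
  constructor
  · intro hy
    obtain ⟨x, rfl⟩ := hM.exact (fun y hy => (hfg y).1 hy) hy
    exact ⟨τX x, (hf' x).symm⟩
  · rintro ⟨x, hx⟩
    obtain ⟨x, rfl⟩ := τX.surjective x
    rw [← hf'] at hx
    rw [← τY.injective hx, ← btmapRight_comp,
      show g ∘ₗ f = 0 from LinearMap.ext hfg.apply_apply_eq_zero, btmapRight_zero]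

/-- The matrix is diagonal with entries `0` and `1`, which every ring homomorphism preserves. -/
theorem mapMatrix_lfilter {K S I : Type u} [Ring K] [Ring S] (φ : K →+* S) (p : I → Prop)
    [DecidablePred p] : mapMatrix φ (lfilter p : (I →₀ K) →ₗ[K] (I →₀ K)) = lfilter p := by
  refine Finsupp.lhom_ext' fun i => LinearMap.ext_ring ?_
  rw [LinearMap.comp_apply, LinearMap.comp_apply, Finsupp.lsingle_apply, mapMatrix_single,
    one_smul, lfilter_apply, lfilter_apply]
  by_cases hi : p i
  · rw [Finsupp.filter_single_of_pos _ hi, Finsupp.filter_single_of_pos _ hi,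
      Finsupp.mapRange_single, map_one]
  · rw [Finsupp.filter_single_of_neg _ hi, Finsupp.filter_single_of_neg _ hi,
      Finsupp.mapRange_zero]

/-! ### Projections on the components -/

section Projections

variable {S B : Type u} [Ring S] [Ring B] {η : S →+* B} {ℬ : ℕ → AddSubgroup B} [GradedRing ℬ]
  (h : IsDegreeZero η ℬ)

include h in
theorem IsDegreeZero.proj_unit_mul (n : ℕ) (s : S) (b : B) :
    GradedRing.proj ℬ n (η s * b) = η s * GradedRing.proj ℬ n b := by
  refine DirectSum.coe_decompose_mul_of_left_mem_zero ℬ ?_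
  rw [← SetLike.mem_coe, ← h.range_eq]
  exact ⟨s, rfl⟩

/-- The projection of `B` on `B_n` as an `S`-linear map. -/
def IsDegreeZero.projLinear (n : ℕ) : LeftVia η →ₗ[S] component η ℬ h n where
  toFun := fun b => ⟨GradedRing.proj ℬ n b, (DirectSum.decompose ℬ (show B from b) n).2⟩
  map_add' := fun b b' => Subtype.ext (map_add (GradedRing.proj ℬ n) b b')
  map_smul' := fun s b => Subtype.ext (h.proj_unit_mul n s b)

/-- The projection of `B` on `B_n` as an `S`-linear endomorphism. -/
def IsDegreeZero.projEnd (n : ℕ) : LeftVia η →ₗ[S] LeftVia η :=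
  (component η ℬ h n).subtype ∘ₗ h.projLinear n

end Projections

/-! ### Graded base change -/

section GradedBaseChange

variable {K R C B : Type u} [Ring K] [Ring R] [Ring C] [Ring B]

/-- A commutative square of ring homomorphisms `K → C → B` and `K → R → B` with
`R ⊗_K C ≅ B`, where `C → B` is a homomorphism of graded rings with `K ≅ C_0`, and where `R` is
mapped to `B_0`. -/
structure IsGradedBaseChange (ηC : K →+* C) (ηR : K →+* R) (φ : C →+* B) (ηB : R →+* B)
    (𝒞 : ℕ → AddSubgroup C) (ℬ : ℕ → AddSubgroup B) : Prop where
  comm : ηB.comp ηR = φ.comp ηC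
  bijective : Function.Bijective (productMap ηC ηR φ ηB comm)
  degreeZero : IsDegreeZero ηC 𝒞
  map_mem : ∀ {n : ℕ} {c : C}, c ∈ 𝒞 n → φ c ∈ ℬ n
  unit_mem : ∀ r, ηB r ∈ ℬ 0

namespace IsGradedBaseChange

variable {ηC : K →+* C} {ηR : K →+* R} {φ : C →+* B} {ηB : R →+* B}
  {𝒞 : ℕ → AddSubgroup C} {ℬ : ℕ → AddSubgroup B}
  (H : IsGradedBaseChange ηC ηR φ ηB 𝒞 ℬ)

/-- The isomorphism `R ⊗_K C ≅ B`. -/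
def equiv : BTensor K (RightVia ηR) (LeftVia ηC) ≃+ B :=
  AddEquiv.ofBijective (productMap ηC ηR φ ηB H.comm).toAddMonoidHom H.bijective

theorem equiv_btmul (r : R) (c : C) :
    H.equiv (btmul K (show RightVia ηR from r) (show LeftVia ηC from c)) = ηB r * φ c := rfl

/-- The isomorphism `R ⊗_K C^(I) ≅ B^(I)`. -/
def finsuppEquiv (I : Type u) :
    BTensor K (RightVia ηR) (I →₀ LeftVia ηC) ≃+ (I →₀ B) :=
  BTensor.finsuppEquiv I H.equiv

theorem finsuppEquiv_btmul {I : Type u} (r : R) (f : I →₀ C) :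
    H.finsuppEquiv I (btmul K (show RightVia ηR from r) (show I →₀ LeftVia ηC from f)) =
      ηB r • Finsupp.mapRange φ (map_zero φ) f := by
  ext i
  rw [Finsupp.smul_apply, Finsupp.mapRange_apply]
  rfl

variable (ηC) in
/-- A map of free `C`-modules as a `K`-linear map. -/
def restrictScalars {I J : Type u} (d : (I →₀ C) →ₗ[C] (J →₀ C)) :
    (I →₀ LeftVia ηC) →ₗ[K] (J →₀ LeftVia ηC) where
  toFun := d
  map_add' := fun f g => d.map_add f g
  map_smul' := fun k f => d.map_smul (ηC k) f

theorem finsuppEquiv_btmapRight {I J : Type u} (d : (I →₀ C) →ₗ[C] (J →₀ C))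
    (x : BTensor K (RightVia ηR) (I →₀ LeftVia ηC)) :
    H.finsuppEquiv J (btmapRight (RightVia ηR) (restrictScalars ηC d) x) =
      mapMatrix φ d (H.finsuppEquiv I x) :=
  DFunLike.congr_fun
    (f := (H.finsuppEquiv J).toAddMonoidHom.comp
      (btmapRight (RightVia ηR) (restrictScalars ηC d)))
    (g := (mapMatrix φ d).toAddMonoidHom.comp (H.finsuppEquiv I).toAddMonoidHom)
    (BTensor.hom_ext fun r f => by
      have h1 := H.finsuppEquiv_btmul r (d f)
      have h2 := H.finsuppEquiv_btmul r f
      exact h1.trans ((mapMatrix_smul_mapRange φ d (ηB r) f).symm.trans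
        (congrArg (mapMatrix φ d) h2.symm))) x

/-- A `K`-linear form on `C` extends to an `R`-linear form on `B ≅ R ⊗_K C`. -/
def extendForm (f : LeftVia ηC →ₗ[K] K) : LeftVia ηB →ₗ[R] R where
  toFun := fun b => rightViaEquiv ηR (btmapRight _ f (H.equiv.symm (show B from b)))
  map_add' := fun (b b' : B) => by
    change rightViaEquiv ηR (btmapRight _ f (H.equiv.symm (b + b'))) = _
    rw [map_add, map_add, map_add]
  map_smul' := fun r b => by
    obtain ⟨x, rfl⟩ := H.equiv.surjective b
    rw [RingHom.id_apply, smul_eq_mul]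
    change rightViaEquiv ηR (btmapRight _ f (H.equiv.symm (ηB r * H.equiv x))) =
      r * rightViaEquiv ηR (btmapRight _ f (H.equiv.symm (H.equiv x)))
    have key : ∀ (r' : R) (c : C), rightViaEquiv ηR (btmapRight _ f
        (H.equiv.symm (ηB r * H.equiv (btmul K (show RightVia ηR from r') c)))) =
        r * rightViaEquiv ηR (btmapRight _ f (btmul K (show RightVia ηR from r') c)) := by
      intro r' c
      have h1 : ηB r * H.equiv (btmul K (show RightVia ηR from r') c) =
          H.equiv (btmul K (show RightVia ηR from r * r') c) := by
        change ηB r * (ηB r' * φ c) = ηB (r * r') * φ c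
        rw [map_mul, mul_assoc]
      rw [h1, H.equiv.symm_apply_apply]
      exact mul_assoc r r' _
    rw [H.equiv.symm_apply_apply]
    induction x using BTensor.induction with
    | zero => rw [map_zero, mul_zero, map_zero, map_zero, map_zero, mul_zero]
    | add x y hx hy => rw [map_add, mul_add, map_add, map_add, map_add, hx, hy, map_add, map_add,
        mul_add]
    | btmul r' c => exact key r' c

theorem extendForm_equiv (f : LeftVia ηC →ₗ[K] K)
    (x : BTensor K (RightVia ηR) (LeftVia ηC)) :
    H.extendForm f (H.equiv x) = rightViaEquiv ηR (btmapRight _ f x) := by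
  change rightViaEquiv ηR (btmapRight _ f (H.equiv.symm (H.equiv x))) = _
  rw [H.equiv.symm_apply_apply]

variable [GradedRing 𝒞]

/-- The augmentation of `C` as a `K`-linear map. -/
def augLinear : LeftVia ηC →ₗ[K] K where
  toFun := fun c => H.degreeZero.augmentation (show C from c)
  map_add' := fun c c' => map_add H.degreeZero.augmentation c c'
  map_smul' := fun k c => by
    refine (map_mul H.degreeZero.augmentation (ηC k) c).trans ?_
    rw [H.degreeZero.augmentation_unit]
    rfl

variable [GradedRing ℬ]

include H in
theorem map_proj (n : ℕ) (c : C) : φ (GradedRing.proj 𝒞 n c) = GradedRing.proj ℬ n (φ c) := by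
  simp only [GradedRing.proj_apply]
  induction c using DirectSum.Decomposition.inductionOn 𝒞 with
  | zero => simp
  | @homogeneous i c =>
    by_cases hi : i = n
    · subst hi
      rw [DirectSum.decompose_of_mem_same _ c.2, DirectSum.decompose_of_mem_same _ (H.map_mem c.2)]
    · rw [DirectSum.decompose_of_mem_ne _ c.2 hi, DirectSum.decompose_of_mem_ne _ (H.map_mem c.2) hi,
        map_zero]
  | add c c' hc hc' => simp [hc, hc']

/-- As `R` lies in degree zero, the grading of `B` is that of `C` tensored with `R`. Statements
about `B_n` can therefore be checked on `R ⊗_K C`. -/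
theorem equiv_proj (n : ℕ) (x : BTensor K (RightVia ηR) (LeftVia ηC)) :
    H.equiv (btmapRight _ (H.degreeZero.projEnd n) x) =
      GradedRing.proj ℬ n (H.equiv x) :=
  DFunLike.congr_fun
    (f := H.equiv.toAddMonoidHom.comp
      (btmapRight _ (H.degreeZero.projEnd n)))
    (g := (GradedRing.proj ℬ n).comp H.equiv.toAddMonoidHom)
    (BTensor.hom_ext fun (r : R) (c : C) => by
      change ηB r * φ (GradedRing.proj 𝒞 n c) = GradedRing.proj ℬ n (ηB r * φ c)
      rw [H.map_proj]
      exact (DirectSum.coe_decompose_mul_of_left_mem_zero ℬ (H.unit_mem r)).symm) x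

theorem equiv_proj_of_mem {n : ℕ} {x : BTensor K (RightVia ηR) (LeftVia ηC)}
    (hx : H.equiv x ∈ ℬ n) :
    H.equiv (btmapRight _ (H.degreeZero.projEnd n) x) =
      H.equiv x := by
  rw [equiv_proj, GradedRing.proj_apply, DirectSum.decompose_of_mem_same _ hx]

include H in
-- Injectivity: the augmentation of `C` induces `R ⊗_K C → R ⊗_K K ≅ R`, which sends `r ⊗ 1` to `r`.
-- For the image: the degree zero part of `r ⊗ c` is `r ⊗ c_0` with `c_0` coming from `K`, and this
-- scalar moves across the tensor sign into `R`.
theorem isDegreeZero : IsDegreeZero ηB ℬ where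
  injective := by
    rw [injective_iff_map_eq_zero]
    intro r hr
    have h1 : btmul K (show RightVia ηR from r) (show LeftVia ηC from (1 : C)) = 0 := by
      rw [← map_eq_zero_iff _ H.equiv.injective, equiv_btmul, hr, zero_mul]
    have h2 := congrArg (rightViaEquiv ηR) (congrArg (btmapRight _ H.augLinear) h1)
    rw [map_zero, map_zero] at h2
    refine Eq.trans ?_ h2
    change r = r * ηR (H.degreeZero.augmentation 1)
    rw [map_one, map_one, mul_one]
  range_eq := by
    refine Set.Subset.antisymm ?_ ?_
    · rintro _ ⟨r, rfl⟩
      exact H.unit_mem r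
    · intro b hb
      obtain ⟨x, rfl⟩ := H.equiv.surjective b
      rw [← H.equiv_proj_of_mem hb]
      change _ ∈ ηB.range
      clear hb
      induction x using BTensor.induction with
      | zero => rw [map_zero, map_zero]; exact Subring.zero_mem _
      | add x y hx hy => rw [map_add, map_add]; exact Subring.add_mem _ hx hy
      | btmul r c =>
        have h1 : GradedRing.proj 𝒞 0 c ∈ Set.range ηC := by
          rw [H.degreeZero.range_eq]
          exact (DirectSum.decompose 𝒞 (show C from c) 0).2
        obtain ⟨k, hk⟩ := h1
        refine ⟨(show R from r) * ηR k, ?_⟩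
        change _ = ηB r * φ (GradedRing.proj 𝒞 0 c)
        rw [← hk, map_mul]
        congr 1
        exact RingHom.congr_fun H.comm k

theorem augmentation_map (c : C) : H.isDegreeZero.augmentation (φ c) =
    ηR (H.degreeZero.augmentation c) := by
  induction c using DirectSum.Decomposition.inductionOn 𝒞 with
  | zero => simp
  | @homogeneous i c =>
    by_cases hi : i = 0
    · subst hi
      obtain ⟨k, hk⟩ : (c : C) ∈ Set.range ηC := by
        rw [H.degreeZero.range_eq]
        exact c.2
      rw [← hk, H.degreeZero.augmentation_unit, ← RingHom.comp_apply φ, ← H.comm,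
        RingHom.comp_apply, H.isDegreeZero.augmentation_unit]
    · rw [H.degreeZero.augmentation_of_pos hi c.2,
        H.isDegreeZero.augmentation_of_pos hi (H.map_mem c.2), map_zero]
  | add c c' hc hc' => simp [hc, hc']

/-- A finite dual basis `(c i, f i)` of `C_n` over `K` gives one of `B_n` over `R`: the elements `φ
(c i)` with the forms `R ⊗ f i`. -/
theorem isLeftFGProjective (hC : IsLeftFGProjective ηC 𝒞 H.degreeZero) :
    IsLeftFGProjective ηB ℬ H.isDegreeZero := by
  intro n
  obtain ⟨hfin, hproj⟩ := hC n
  obtain ⟨m, s, hs⟩ := Module.Finite.exists_fin' K (component ηC 𝒞 H.degreeZero n)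
  obtain ⟨t, ht⟩ := Module.projective_lifting_property s LinearMap.id hs
  let c : Fin m → C := fun i => (s (Pi.single i 1)).1
  have hc : ∀ i, c i ∈ 𝒞 n := fun i => (s (Pi.single i 1)).2
  -- The dual forms are extended by zero from `C_n` to `C` through the projection, so that they can
  -- be tensored with `R` on all of `R ⊗_K C ≅ B`.
  let f : Fin m → (LeftVia ηC →ₗ[K] K) := fun i => LinearMap.proj i ∘ₗ t ∘ₗ H.degreeZero.projLinear n
  have hf : ∀ x : C, GradedRing.proj 𝒞 n x = ∑ i, ηC (f i x) * c i := by
    intro x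
    have h1 : s (t (H.degreeZero.projLinear n x)) = H.degreeZero.projLinear n x := LinearMap.congr_fun ht _
    rw [← Finset.univ_sum_single (t (H.degreeZero.projLinear n x)), map_sum] at h1
    have h2 := congrArg Subtype.val h1
    rw [AddSubmonoidClass.coe_finsetSum] at h2
    refine Eq.trans h2.symm (Finset.sum_congr rfl fun i _ => ?_)
    rw [← mul_one (t (H.degreeZero.projLinear n x) i), ← smul_eq_mul, Pi.single_smul, map_smul]
    rfl
  have hF : ∀ x : BTensor K (RightVia ηR) (LeftVia ηC),
      GradedRing.proj ℬ n (H.equiv x) =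
        ∑ i, ηB (rightViaEquiv ηR (btmapRight _ (f i) x)) * φ (c i) := by
    intro x
    rw [← equiv_proj]
    have key : ∀ (r : R) (x : C), ηB r * φ (GradedRing.proj 𝒞 n x) =
        ∑ i, ηB (r * ηR (f i x)) * φ (c i) := by
      intro r x
      rw [hf, map_sum, Finset.mul_sum]
      refine Finset.sum_congr rfl fun i _ => ?_
      rw [map_mul, map_mul, mul_assoc]
      congr 2
      exact (RingHom.congr_fun H.comm _).symm
    induction x using BTensor.induction with
    | zero => simp
    | add x y hx hy =>
      simp only [map_add, add_mul, Finset.sum_add_distrib] at hx hy ⊢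
      rw [hx, hy]
    | btmul r x => exact key r x
  let S : (Fin m → R) →ₗ[R] component ηB ℬ H.isDegreeZero n :=
    Fintype.linearCombination R fun i => ⟨φ (c i), H.map_mem (hc i)⟩
  let T : component ηB ℬ H.isDegreeZero n →ₗ[R] (Fin m → R) :=
    LinearMap.pi fun i => H.extendForm (f i) ∘ₗ (component ηB ℬ H.isDegreeZero n).subtype
  -- On `B_n` the projection in `hF` is the identity, which leaves the dual basis expansion. Thus
  -- `B_n` is a retract of `R^m`.
  have hST : S ∘ₗ T = LinearMap.id := by
    refine LinearMap.ext fun b => Subtype.ext ?_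
    obtain ⟨b, hb⟩ := b
    obtain ⟨x, rfl⟩ := H.equiv.surjective b
    have hx : H.equiv x ∈ ℬ n := hb
    have h1 := hF x
    rw [GradedRing.proj_apply, DirectSum.decompose_of_mem_same _ hx] at h1
    rw [LinearMap.id_apply, LinearMap.comp_apply, Fintype.linearCombination_apply,
      AddSubmonoidClass.coe_finsetSum]
    refine Eq.trans (Finset.sum_congr rfl fun i _ => ?_) h1.symm
    exact congrArg (fun r => ηB r * φ (c i)) (H.extendForm_equiv (f i) x)
  exact ⟨Module.Finite.of_surjective S fun b => ⟨T b, LinearMap.congr_fun hST b⟩,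
    Module.Projective.of_split T S hST⟩

/-! ### Base change of free resolutions and of Tor. -/

section Resolution

variable (F : GradedFreeRes H.degreeZero.trivialModule)

/-- The augmentation of a resolution of `K` as a `K`-linear map. -/
def resAugLinear : (F.I 0 →₀ LeftVia ηC) →ₗ[K] K where
  toFun := F.aug
  map_add' := fun f g => F.aug.map_add f g
  map_smul' := fun k f => by
    refine (F.aug.map_smul (ηC k) f).trans ?_
    change H.degreeZero.augmentation (ηC k) * _ = k * _
    rw [H.degreeZero.augmentation_unit]

/-- The augmentation of the base change of a resolution of `K`. -/
def baseChangeAug : (F.I 0 →₀ B) →ₗ[B] LeftVia H.isDegreeZero.augmentation :=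
  Finsupp.linearCombination B
    (fun k => ηR (H.resAugLinear F (Finsupp.single k (1 : C))) :
      F.I 0 → LeftVia H.isDegreeZero.augmentation)

theorem baseChangeAug_single (k : F.I 0) (b : B) : H.baseChangeAug F (Finsupp.single k b) =
    H.isDegreeZero.augmentation b * ηR (H.resAugLinear F (Finsupp.single k (1 : C))) :=
  Finsupp.linearCombination_single B b k

theorem baseChangeAug_mapRange (f : F.I 0 →₀ C) :
    H.baseChangeAug F (Finsupp.mapRange φ (map_zero φ) f) = ηR (H.resAugLinear F f) := by
  refine DFunLike.congr_fun
    (f := (H.baseChangeAug F).toAddMonoidHom.comp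
      (Finsupp.mapRange.addMonoidHom φ.toAddMonoidHom : (F.I 0 →₀ C) →+ (F.I 0 →₀ B)))
    (g := ηR.toAddMonoidHom.comp (H.resAugLinear F).toAddMonoidHom)
    (Finsupp.addHom_ext fun k c => ?_) f
  change H.baseChangeAug F (Finsupp.mapRange φ (map_zero φ) (Finsupp.single k c)) =
    ηR (F.aug (Finsupp.single k c))
  rw [Finsupp.mapRange_single]
  refine (H.baseChangeAug_single F k (φ c)).trans ?_
  rw [H.augmentation_map, ← map_mul]
  congr 1
  refine (F.aug.map_smul c (Finsupp.single k 1)).symm.trans ?_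
  rw [Finsupp.smul_single, smul_eq_mul, mul_one]

theorem baseChangeAug_smul_mapRange (r : R) (f : F.I 0 →₀ C) :
    H.baseChangeAug F (ηB r • Finsupp.mapRange φ (map_zero φ) f) =
      r * ηR (H.resAugLinear F f) := by
  rw [← H.baseChangeAug_mapRange, map_smul]
  change H.isDegreeZero.augmentation (ηB r) * _ = _
  rw [H.isDegreeZero.augmentation_unit]

/-- Identifies the augmentation of the base change with `R ⊗_K` the original one, as needed to
transport exactness at the end of the resolution. -/
theorem rightViaEquiv_resAugLinear (x : BTensor K (RightVia ηR) (F.I 0 →₀ LeftVia ηC)) :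
    rightViaEquiv ηR (btmapRight _ (H.resAugLinear F) x) =
      H.baseChangeAug F (H.finsuppEquiv _ x) :=
  DFunLike.congr_fun
    (f := (rightViaEquiv ηR).toAddMonoidHom.comp (btmapRight _ (H.resAugLinear F)))
    (g := (H.baseChangeAug F).toAddMonoidHom.comp (H.finsuppEquiv _).toAddMonoidHom)
    (BTensor.hom_ext fun r f => by
      have h1 := H.finsuppEquiv_btmul r f
      exact (H.baseChangeAug_smul_mapRange F r f).symm.trans
        (congrArg (H.baseChangeAug F) h1.symm)) x

/-- The base change of a graded free resolution of `K` over `C` is a graded free resolution of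
`R` over `B`. -/
def baseChangeRes (hR : IsRightFlat K (RightVia ηR)) :
    GradedFreeRes H.isDegreeZero.trivialModule where
  I := F.I
  δ := F.δ
  d := fun i => mapMatrix φ (F.d i)
  d_mem := fun i k l => by
    rw [mapMatrix_single, one_smul, Finsupp.mapRange_apply]
    have := F.d_mem i k l
    unfold shiftDeg at this ⊢
    split_ifs at this ⊢ with h
    · exact H.map_mem this
    · rw [AddSubgroup.mem_bot] at this ⊢
      rw [this, map_zero]
  aug := H.baseChangeAug F
  aug_mem := fun k => by
    have h1 : F.aug (Finsupp.single k 1) ∈ degZero _ (F.δ 0 k) := F.aug_mem k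
    change _ ∈ degZero (LeftVia H.isDegreeZero.augmentation) (F.δ 0 k)
    unfold degZero at h1 ⊢
    split_ifs at h1 ⊢ with h
    · exact AddSubgroup.mem_top _
    · rw [AddSubgroup.mem_bot] at h1
      refine AddSubgroup.mem_bot.2 ((H.baseChangeAug_single F k 1).trans ?_)
      rw [show H.resAugLinear F (Finsupp.single k (1 : C)) = 0 from h1, map_zero, mul_zero]
      rfl
  -- A preimage `f` of `1 ∈ K`, pushed to `B` and multiplied by `r`, maps to `r`.
  aug_surjective := fun (r : R) => by
    obtain ⟨f, hf⟩ := F.aug_surjective (show LeftVia H.degreeZero.augmentation from (1 : K))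
    refine ⟨ηB r • Finsupp.mapRange φ (map_zero φ) f,
      (H.baseChangeAug_smul_mapRange F r f).trans ?_⟩
    rw [show H.resAugLinear F f = 1 from hf, map_one, mul_one]
  -- Viewed over `K`, the resolution is an exact sequence of left `K`-modules, and flatness of `R`
  -- keeps it exact. The isomorphisms `R ⊗_K C^(I) ≅ B^(I)` then identify the result with the
  -- sequence of matrices over `B`.
  exact_zero := hR.function_exact (f := restrictScalars ηC (F.d 0)) (g := H.resAugLinear F)
    (f' := (mapMatrix φ (F.d 0)).toAddMonoidHom) (g' := (H.baseChangeAug F).toAddMonoidHom)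
    F.exact_zero (H.finsuppEquiv _) (H.finsuppEquiv _) (rightViaEquiv ηR)
    (H.finsuppEquiv_btmapRight _) (H.rightViaEquiv_resAugLinear F)
  exact_succ := fun i => hR.function_exact (f := restrictScalars ηC (F.d (i + 1)))
    (g := restrictScalars ηC (F.d i)) (f' := (mapMatrix φ (F.d (i + 1))).toAddMonoidHom)
    (g' := (mapMatrix φ (F.d i)).toAddMonoidHom) (F.exact_succ i)
    (H.finsuppEquiv _) (H.finsuppEquiv _) (H.finsuppEquiv _)
    (H.finsuppEquiv_btmapRight _) (H.finsuppEquiv_btmapRight _)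

/-- In matrix form, this is the isomorphism between `R ⊗_B (R ⊗_K F)` and `R ⊗_K (K ⊗_C F)`: the two
composites `C → B → R` and `C → K → R` agree. -/
theorem mapMatrix_augmentation {I J : Type u} (d : (I →₀ C) →ₗ[C] (J →₀ C)) :
    mapMatrix H.isDegreeZero.augmentation (mapMatrix φ d) =
      mapMatrix ηR (mapMatrix H.degreeZero.augmentation d) := by
  rw [mapMatrix_mapMatrix, mapMatrix_mapMatrix]
  congr 1
  exact RingHom.ext H.augmentation_map

end Resolution

/-- Exactness of matrices in a set of coordinates is preserved by flat base change. -/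
theorem _root_.RelKoszul.IsRightFlat.exists_mapMatrix_eq (hR : IsRightFlat K (RightVia ηR))
    {I J L : Type u} {d : (I →₀ K) →ₗ[K] (J →₀ K)} {d' : (J →₀ K) →ₗ[K] (L →₀ K)} {p : J → Prop}
    [DecidablePred p]
    (h : ∀ g, d' g = 0 → g.filter p = 0 → ∃ f, d f = g) {g : J →₀ R}
    (hg : mapMatrix ηR d' g = 0) (hgp : g.filter p = 0) : ∃ f, mapMatrix ηR d f = g := by
  obtain ⟨x, rfl⟩ := (rightViaFinsuppEquiv ηR J).surjective g
  -- Both conditions on `g` are kernels of matrices defined over `K`, so flatness applies to their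
  -- intersection.
  obtain ⟨y, rfl⟩ := hR.exact_inf (g₁ := d') (g₂ := lfilter p) (f := d) (x := x) h
    (by rw [← map_eq_zero_iff _ (rightViaFinsuppEquiv ηR L).injective,
      rightViaFinsuppEquiv_btmapRight, hg])
    (by rw [← map_eq_zero_iff _ (rightViaFinsuppEquiv ηR J).injective,
      rightViaFinsuppEquiv_btmapRight, mapMatrix_lfilter, lfilter_apply, hgp])
  exact ⟨rightViaFinsuppEquiv ηR I y, (rightViaFinsuppEquiv_btmapRight ηR d y).symm⟩

/-- Replace the chosen resolutions by a free one over `C` and by its base change over `B`. The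
reduced matrices over `R` are then the images of those over `K`, and flatness transfers exactness in
the given bidegree. -/
theorem subsingleton_tor (hR : IsRightFlat K (RightVia ηR)) {i j : ℕ}
    (hC : Subsingleton (H.degreeZero.tor i j)) : Subsingleton (H.isDegreeZero.tor i j) := by
  obtain ⟨F⟩ := nonempty_gradedFreeRes H.degreeZero.trivialModule
  have hF := GradedProjRes.subsingleton_homology_of (P := F.toGradedProjRes) _ _ hC
  refine GradedProjRes.subsingleton_homology_of _ (H.baseChangeRes F hR).toGradedProjRes ?_
  cases i with
  | zero =>
    rw [GradedFreeRes.subsingleton_homology_zero_iff] at hF ⊢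
    intro g hg
    change ∃ f, mapMatrix _ (mapMatrix φ (F.d 0)) f = g
    rw [H.mapMatrix_augmentation]
    -- In homological degree zero there is no cycle condition, so the degree filter also stands in
    -- for the outgoing differential.
    refine hR.exists_mapMatrix_eq (d' := lfilter fun k => F.δ 0 k ≠ j) (fun g _ hg => hF g hg) ?_ hg
    rw [mapMatrix_lfilter]
    exact hg
  | succ i =>
    rw [GradedFreeRes.subsingleton_homology_succ_iff] at hF ⊢
    intro g hg hgj
    change mapMatrix _ (mapMatrix φ (F.d i)) g = 0 at hg
    change ∃ f, mapMatrix _ (mapMatrix φ (F.d (i + 1))) f = g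
    rw [H.mapMatrix_augmentation] at hg ⊢
    exact hR.exists_mapMatrix_eq hF hg hgj

include H in
/-- Flat graded base change preserves left finitely projective Koszul graded rings. -/
theorem isLeftFinProjKoszul (hC : IsLeftFinProjKoszul ηC 𝒞)
    (hR : IsRightFlat K (RightVia ηR)) : IsLeftFinProjKoszul ηB ℬ where
  degreeZero := H.isDegreeZero
  fgProjective := H.isLeftFGProjective hC.fgProjective
  flatKoszul :=
    { flat := fun n => by
        have := (H.isLeftFGProjective hC.fgProjective n).2
        exact isLeftFlat_of_projective _
      tor_eq_zero := fun i j hij => H.subsingleton_tor hR (hC.flatKoszul.tor_eq_zero i j hij) }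

end IsGradedBaseChange

end GradedBaseChange

/-! ### The associated graded ring of a ring of the form `R ⊗_K C` -/

section HalfBaseChangeGr

variable {K R C A : Type u} [Ring K] [Ring R] [Ring C] [Ring A]
  {ηC : K →+* C} {ηR : K →+* R} {ιC : C →+* A} {ηA : R →+* A}
  {𝒞 : ℕ → AddSubgroup C}

theorem le_lengthFilt {i n : ℕ} (h : i ≤ n) : 𝒞 i ≤ lengthFilt 𝒞 n :=
  le_iSup₂_of_le i h le_rfl

theorem mul_mem_productFilt {n : ℕ} (r : R) {c : C} (hc : c ∈ lengthFilt 𝒞 n) :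
    ηA r * ιC c ∈ productFilt ιC ηA 𝒞 n :=
  AddSubgroup.subset_closure ⟨r, c, hc, rfl⟩

theorem mul_mem_prevFilt_productFilt {n : ℕ} (r : R) {c : C}
    (hc : c ∈ prevFilt (lengthFilt 𝒞) n) :
    ηA r * ιC c ∈ prevFilt (productFilt ιC ηA 𝒞) n := by
  cases n with
  | zero =>
    rw [show c = 0 from hc, map_zero, mul_zero]
    exact AddSubgroup.zero_mem _
  | succ n => exact mul_mem_productFilt r hc

theorem map_mem_productFilt {n : ℕ} {c : C} (hc : c ∈ lengthFilt 𝒞 n) :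
    ιC c ∈ productFilt ιC ηA 𝒞 n := by
  have := mul_mem_productFilt (ιC := ιC) (ηA := ηA) 1 hc
  rwa [map_one, one_mul] at this

variable [GradedRing 𝒞]

theorem proj_eq_zero_of_mem_lengthFilt {m n : ℕ} (hmn : m < n) {c : C}
    (hc : c ∈ lengthFilt 𝒞 m) : GradedRing.proj 𝒞 n c = 0 := by
  have : lengthFilt 𝒞 m ≤ (GradedRing.proj 𝒞 n).ker :=
    iSup₂_le fun i hi c hc => DirectSum.decompose_of_mem_ne 𝒞 hc (by omega)
  exact this hc

/-- Modulo `F_{n-1} C` only the component of degree `n` survives. This is what makes `C → gr A`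
reach every symbol once `R` acts. -/
theorem sub_proj_mem_prevFilt {n : ℕ} {c : C} (hc : c ∈ lengthFilt 𝒞 n) :
    c - GradedRing.proj 𝒞 n c ∈ prevFilt (lengthFilt 𝒞) n := by
  have : lengthFilt 𝒞 n ≤ (prevFilt (lengthFilt 𝒞) n).comap
      (AddMonoidHom.id C - GradedRing.proj 𝒞 n) := by
    refine iSup₂_le fun i hi c (hci : c ∈ 𝒞 i) => ?_
    change c - (DirectSum.decompose 𝒞 c n : C) ∈ prevFilt (lengthFilt 𝒞) n
    by_cases h : i = n
    · subst h
      rw [DirectSum.decompose_of_mem_same _ hci, sub_self]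
      exact AddSubgroup.zero_mem _
    · rw [DirectSum.decompose_of_mem_ne _ hci h, sub_zero]
      obtain ⟨n, rfl⟩ := Nat.exists_eq_succ_of_ne_zero (show n ≠ 0 by omega)
      exact le_lengthFilt (show i ≤ n by omega) hci
  exact this hc

variable (hF : IsRingFilt (productFilt ιC ηA 𝒞))

/-- The map `C_n → F n A / F (n - 1) A`. -/
def grMapPiece (n : ℕ) : 𝒞 n →+ GrPiece hF n :=
  (symb hF n).comp
    ((ιC.toAddMonoidHom.comp (𝒞 n).subtype).codRestrict (productFilt ιC ηA 𝒞 n)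
      fun c => map_mem_productFilt (le_lengthFilt le_rfl c.2))

/-- The ring homomorphism `C → gr A`. -/
def grMap : C →+* AssocGr hF :=
  (DirectSum.toSemiring (fun n => (DirectSum.of (GrPiece hF) n).comp (grMapPiece hF n))
    (congrArg (fun x => DirectSum.of (GrPiece hF) 0 (symb hF 0 x)) (Subtype.ext (map_one ιC)))
    (fun {i j} a b => by
      rw [AddMonoidHom.comp_apply, AddMonoidHom.comp_apply, AddMonoidHom.comp_apply,
        DirectSum.of_mul_of]
      exact congrArg (fun x => DirectSum.of (GrPiece hF) (i + j) (symb hF (i + j) x))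
        (Subtype.ext (map_mul ιC (a : C) b)))).comp
    (DirectSum.decomposeRingEquiv 𝒞 : C →+* DirectSum ℕ fun i => 𝒞 i)

theorem grMap_of_mem {n : ℕ} {c : C} (hc : c ∈ 𝒞 n) : grMap hF c =
    DirectSum.of (GrPiece hF) n
      (symb hF n ⟨ιC c, map_mem_productFilt (le_lengthFilt le_rfl hc)⟩) := by
  rw [grMap, RingHom.comp_apply]
  refine (congrArg _ (DirectSum.decompose_of_mem 𝒞 hc)).trans ?_
  exact DirectSum.toSemiring_of (fun n => (DirectSum.of (GrPiece hF) n).comp (grMapPiece hF n))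
    _ _ n ⟨c, hc⟩

theorem grUnit_mul_grMap {n : ℕ} (r : R) {c : C} (hc : c ∈ 𝒞 n) :
    grUnit hF ηA (unit_mem_productFilt ιC ηA 𝒞) r * grMap hF c =
      DirectSum.of (GrPiece hF) n
        (symb hF n ⟨ηA r * ιC c, mul_mem_productFilt r (le_lengthFilt le_rfl hc)⟩) := by
  rw [grMap_of_mem hF hc]
  change DirectSum.of (GrPiece hF) 0 _ * _ = _
  rw [DirectSum.of_mul_of]
  exact DirectSum.of_eq_of_gradedMonoid_eq (mk_symb_eq hF (zero_add n) rfl)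

theorem grMap_comm (hcomm : ηA.comp ηR = ιC.comp ηC) (hdeg : IsDegreeZero ηC 𝒞) :
    (grUnit hF ηA (unit_mem_productFilt ιC ηA 𝒞)).comp ηR = (grMap hF).comp ηC := by
  ext k : 1
  have hk : ηC k ∈ 𝒞 0 := by
    rw [← SetLike.mem_coe, ← hdeg.range_eq]
    exact ⟨k, rfl⟩
  rw [RingHom.comp_apply, RingHom.comp_apply, grMap_of_mem hF hk]
  exact congrArg (fun x => DirectSum.of (GrPiece hF) 0 (symb hF 0 x))
    (Subtype.ext (RingHom.congr_fun hcomm k))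

variable {hcomm : ηA.comp ηR = ιC.comp ηC} (hdeg : IsDegreeZero ηC 𝒞)

/-- A tensor involves finitely many components of `C`. Allowing every `M ≥ N` lets the bounds for
two summands be merged by their maximum. -/
theorem exists_sum_projEnd (x : BTensor K (RightVia ηR) (LeftVia ηC)) :
    ∃ N, ∀ M, N ≤ M → ∑ n ∈ Finset.range M, btmapRight _ (hdeg.projEnd n) x = x := by
  have key : ∀ c : C, ∃ N, ∀ M, N ≤ M →
      ∑ n ∈ Finset.range M, GradedRing.proj 𝒞 n c = c := by
    intro c
    classical
    obtain ⟨N, hN⟩ := (DirectSum.decompose 𝒞 c).support.exists_nat_subset_range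
    refine ⟨N, fun M hM => ?_⟩
    conv_rhs => rw [← DirectSum.sum_support_decompose 𝒞 c]
    refine (Finset.sum_subset (hN.trans (Finset.range_mono hM)) fun n _ hn => ?_).symm
    have h0 : DirectSum.decompose 𝒞 c n = 0 := by simpa using hn
    exact congrArg Subtype.val h0
  induction x using BTensor.induction with
  | zero => exact ⟨0, fun M _ => by simp⟩
  | add x y hx hy =>
    obtain ⟨N, hN⟩ := hx
    obtain ⟨N', hN'⟩ := hy
    refine ⟨max N N', fun M hM => ?_⟩
    simp only [map_add, Finset.sum_add_distrib]
    rw [hN M (le_trans (le_max_left _ _) hM), hN' M (le_trans (le_max_right _ _) hM)]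
  | btmul r c =>
    obtain ⟨N, hN⟩ := key c
    refine ⟨N, fun M hM => ?_⟩
    let f : LeftVia ηC →+ BTensor K (RightVia ηR) (LeftVia ηC) :=
      AddMonoidHom.mk' (btmul K r) (btmul_add r)
    refine (map_sum f (fun n => hdeg.projEnd n c) _).symm.trans ?_
    exact congrArg f (hN M hM)

theorem productMap_projEnd_mem (n : ℕ) (x : BTensor K (RightVia ηR) (LeftVia ηC)) :
    productMap ηC ηR ιC ηA hcomm (btmapRight _ (hdeg.projEnd n) x) ∈ productFilt ιC ηA 𝒞 n := by
  induction x using BTensor.induction with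
  | zero => simp
  | add x y hx hy => rw [map_add, map_add]; exact AddSubgroup.add_mem _ hx hy
  | btmul r c =>
    exact mul_mem_productFilt (show R from r)
      (le_lengthFilt le_rfl (DirectSum.decompose 𝒞 (show C from c) n).2)

/-- The components of the image of `R ⊗_K C` in `gr A`. -/
theorem productMap_grMap_apply (x : BTensor K (RightVia ηR) (LeftVia ηC)) (n : ℕ) :
    productMap ηC ηR (grMap hF) (grUnit hF ηA (unit_mem_productFilt ιC ηA 𝒞))
      (grMap_comm hF hcomm hdeg) x n =
    symb hF n ⟨productMap ηC ηR ιC ηA hcomm (btmapRight _ (hdeg.projEnd n) x),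
      productMap_projEnd_mem hdeg n x⟩ := by
  refine DFunLike.congr_fun
    (f := (DFinsupp.evalAddMonoidHom n : AssocGr hF →+ GrPiece hF n).comp
      (productMap ηC ηR (grMap hF) (grUnit hF ηA (unit_mem_productFilt ιC ηA 𝒞))
        (grMap_comm hF hcomm hdeg)).toAddMonoidHom)
    (g := (symb hF n).comp
      (((productMap ηC ηR ιC ηA hcomm).toAddMonoidHom.comp
        (btmapRight _ (hdeg.projEnd n))).codRestrict (productFilt ιC ηA 𝒞 n)
          (productMap_projEnd_mem (hcomm := hcomm) hdeg n)))
    (BTensor.hom_ext fun (r : R) (c : C) => ?_) x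
  have hmem : ∀ c : C, (ηA r * ιC (GradedRing.proj 𝒞 n c)) ∈ productFilt ιC ηA 𝒞 n :=
    fun c => mul_mem_productFilt r (le_lengthFilt le_rfl (DirectSum.decompose 𝒞 c n).2)
  -- Both sides are additive in `c`, so `c` may be taken homogeneous. In its own degree the two
  -- symbols coincide, and in every other degree both sides vanish.
  refine DFunLike.congr_fun
    (f := (DFinsupp.evalAddMonoidHom n : AssocGr hF →+ GrPiece hF n).comp
      ((AddMonoidHom.mulLeft (grUnit hF ηA (unit_mem_productFilt ιC ηA 𝒞) r)).comp
        (grMap hF).toAddMonoidHom))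
    (g := (symb hF n).comp
      (((AddMonoidHom.mulLeft (ηA r)).comp
        (ιC.toAddMonoidHom.comp (GradedRing.proj 𝒞 n))).codRestrict (productFilt ιC ηA 𝒞 n)
          hmem))
    (eq_of_eq_on_deg (DirectSum.Decomposition.isInternal 𝒞) fun m c hc => ?_) c
  change (grUnit hF ηA (unit_mem_productFilt ιC ηA 𝒞) r * grMap hF c) n =
    symb hF n ⟨ηA r * ιC (DirectSum.decompose 𝒞 c n), hmem c⟩
  rw [grUnit_mul_grMap hF r hc]
  by_cases hmn : m = n
  · subst hmn
    rw [DirectSum.of_eq_same]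
    congr 2
    rw [DirectSum.decompose_of_mem_same _ hc]
  · rw [DirectSum.of_eq_of_ne _ _ _ (Ne.symm hmn), eq_comm, symb_eq_zero]
    change ηA r * ιC (DirectSum.decompose 𝒞 c n) ∈ _
    rw [DirectSum.decompose_of_mem_ne _ hc hmn, map_zero, mul_zero]
    exact AddSubgroup.zero_mem _

/-- By bijectivity, `F_m A` corresponds to the subgroup of `R ⊗_K C` generated by the `r ⊗ c` with
`c ∈ F_m C`, and `p_n` kills such `c` when `n > m`. -/
theorem projEnd_eq_zero_of_mem (hA : Function.Bijective (productMap ηC ηR ιC ηA hcomm))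
    {m n : ℕ} (hmn : m < n) {x : BTensor K (RightVia ηR) (LeftVia ηC)}
    (hx : productMap ηC ηR ιC ηA hcomm x ∈ productFilt ιC ηA 𝒞 m) :
    btmapRight _ (hdeg.projEnd n) x = 0 := by
  let e := AddEquiv.ofBijective (productMap ηC ηR ιC ηA hcomm).toAddMonoidHom hA
  have hle : productFilt ιC ηA 𝒞 m ≤
      ((btmapRight _ (hdeg.projEnd n)).comp e.symm.toAddMonoidHom).ker := by
    rw [productFilt, AddSubgroup.closure_le]
    rintro _ ⟨r, c, hc, rfl⟩
    change btmapRight _ (hdeg.projEnd n) (e.symm (ηA r * ιC c)) = 0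
    have h1 : e.symm (ηA r * ιC c) =
        btmul K (show RightVia ηR from r) (show LeftVia ηC from c) :=
      (e.symm_apply_eq).2 rfl
    rw [h1, btmapRight_btmul,
      show hdeg.projEnd n (show LeftVia ηC from c) = (0 : LeftVia ηC) from
        proj_eq_zero_of_mem_lengthFilt (C := C) hmn hc, btmul_zero]
  have h2 : btmapRight _ (hdeg.projEnd n) (e.symm (e x)) = 0 := hle hx
  rwa [e.symm_apply_apply] at h2

theorem projEnd_projEnd (n : ℕ) (x : BTensor K (RightVia ηR) (LeftVia ηC)) :
    btmapRight _ (hdeg.projEnd n) (btmapRight _ (hdeg.projEnd n) x) =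
      btmapRight _ (hdeg.projEnd n) x := by
  rw [← btmapRight_comp]
  refine DFunLike.congr_fun (congrArg (btmapRight _) (LinearMap.ext fun c => ?_)) x
  exact DirectSum.decompose_of_mem_same 𝒞 (DirectSum.decompose 𝒞 (show C from c) n).2

/-- If `x` maps to zero, the image in `A` of its `n`-th component lies in `F_{n-1} A`. That
component is then killed by `id ⊗ p_n`, which also fixes it, so it is zero; and `x` is the sum of
its components. -/
theorem productMap_grMap_injective (hA : Function.Bijective (productMap ηC ηR ιC ηA hcomm)) :
    Function.Injective (productMap ηC ηR (grMap hF)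
      (grUnit hF ηA (unit_mem_productFilt ιC ηA 𝒞)) (grMap_comm hF hcomm hdeg)) := by
  rw [injective_iff_map_eq_zero]
  intro x hx
  have hzero : ∀ n, btmapRight _ (hdeg.projEnd n) x = 0 := by
    intro n
    have h1 := productMap_grMap_apply hF (hcomm := hcomm) hdeg x n
    rw [hx] at h1
    have h2 := (symb_eq_zero hF).1 h1.symm
    cases n with
    -- Here `F_{-1} A = 0`, and injectivity of the product map suffices.
    | zero =>
      apply hA.1
      rw [map_zero]
      exact h2
    | succ n =>
      rw [← projEnd_projEnd]
      exact projEnd_eq_zero_of_mem hdeg hA (Nat.lt_succ_self n) h2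
  obtain ⟨N, hN⟩ := exists_sum_projEnd hdeg x
  rw [← hN N le_rfl]
  exact Finset.sum_eq_zero fun n _ => hzero n

/-- `F_n A` is generated by products `r c` with `c ∈ F_n C`, and replacing `c` by its component of
degree `n` changes `r c` only by an element of `F_{n-1} A`. -/
theorem productMap_grMap_surjective :
    Function.Surjective (productMap ηC ηR (grMap hF)
      (grUnit hF ηA (unit_mem_productFilt ιC ηA 𝒞)) (grMap_comm hF hcomm hdeg)) := by
  let q := (productMap ηC ηR (grMap hF)
    (grUnit hF ηA (unit_mem_productFilt ιC ηA 𝒞)) (grMap_comm hF hcomm hdeg)).toAddMonoidHom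
  suffices h : ∀ y, y ∈ q.range from h
  intro y
  induction y using DirectSum.induction_on with
  | zero => exact AddSubgroup.zero_mem _
  | add x y hx hy => exact AddSubgroup.add_mem _ hx hy
  | of n y =>
    obtain ⟨⟨a, ha⟩, rfl⟩ := symb_surjective hF n y
    induction ha using AddSubgroup.closure_induction with
    | mem a ha =>
      obtain ⟨r, c, hc, rfl⟩ := ha
      have hcn : GradedRing.proj 𝒞 n c ∈ 𝒞 n := (DirectSum.decompose 𝒞 c n).2
      refine ⟨btmul K (show RightVia ηR from r)
        (show LeftVia ηC from GradedRing.proj 𝒞 n c), ?_⟩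
      change grUnit hF ηA (unit_mem_productFilt ιC ηA 𝒞) r * grMap hF _ = _
      rw [grUnit_mul_grMap hF r hcn]
      congr 1
      rw [eq_comm, ← sub_eq_zero, ← map_sub, symb_eq_zero]
      change ηA r * ιC c - ηA r * ιC (GradedRing.proj 𝒞 n c) ∈ _
      rw [← mul_sub, ← map_sub]
      exact mul_mem_prevFilt_productFilt r (sub_proj_mem_prevFilt hc)
    | zero =>
      have : symb hF n ⟨0, AddSubgroup.zero_mem _⟩ = 0 := map_zero (symb hF n)
      rw [this, map_zero]
      exact AddSubgroup.zero_mem _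
    | add a b ha hb iha ihb =>
      have : symb hF n ⟨a + b, AddSubgroup.add_mem _ ha hb⟩ =
        symb hF n ⟨a, ha⟩ + symb hF n ⟨b, hb⟩ := map_add (symb hF n) ⟨a, ha⟩ ⟨b, hb⟩
      rw [this, map_add]
      exact AddSubgroup.add_mem _ iha ihb
    | neg a ha iha =>
      have : symb hF n ⟨-a, AddSubgroup.neg_mem _ ha⟩ = -symb hF n ⟨a, ha⟩ :=
        map_neg (symb hF n) ⟨a, ha⟩
      rw [this, map_neg]
      exact AddSubgroup.neg_mem _ iha

include hdeg in
/-- The associated graded ring of `A ≅ R ⊗_K C` is `R ⊗_K C`. -/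
theorem isGradedBaseChange_assocGr (hA : Function.Bijective (productMap ηC ηR ιC ηA hcomm)) :
    IsGradedBaseChange ηC ηR (grMap hF) (grUnit hF ηA (unit_mem_productFilt ιC ηA 𝒞)) 𝒞
      (grDeg hF) where
  comm := grMap_comm hF hcomm hdeg
  bijective := ⟨productMap_grMap_injective hF hdeg hA, productMap_grMap_surjective hF (hcomm := hcomm) hdeg⟩
  degreeZero := hdeg
  map_mem := fun hc => ⟨_, (grMap_of_mem hF hc).symm⟩
  unit_mem := fun _ => ⟨_, rfl⟩

end HalfBaseChangeGr

end RelKoszul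
end

theorem mainTheorem9 {K R C A : Type u} [Ring K] [Ring R] [Ring C] [Ring A]
    (ηC : K →+* C) (ηR : K →+* R) (ιC : C →+* A) (ηA : R →+* A)
    (hcomm : ηA.comp ηR = ιC.comp ηC)
    (hA : Function.Bijective (RelKoszul.productMap ηC ηR ιC ηA hcomm))
    (𝒞 : ℕ → AddSubgroup C) [GradedRing 𝒞]
    (hC : RelKoszul.IsLeftFinProjKoszul ηC 𝒞)
    (hF : RelKoszul.IsRingFilt (RelKoszul.productFilt ιC ηA 𝒞))
    (hR : RelKoszul.IsRightFlat K (RelKoszul.RightVia ηR)) :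
    RelKoszul.IsLeftFinProjKoszul
      (RelKoszul.grUnit hF ηA (RelKoszul.unit_mem_productFilt ιC ηA 𝒞)) (RelKoszul.grDeg hF) :=
  (RelKoszul.isGradedBaseChange_assocGr hF hC.degreeZero hA).isLeftFinProjKoszul hC hR
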